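/- **Setting.** Let $G$ be a finite undirected graph without loops, with edge weights $w_{xy}=w_{yx}>0$ and total weight $W=\sum_{xy\in E}w_{xy}$. Let $M$ be a set of marked vertices and let $\sigma$ be a probability distribution on the vertices. A unit flow from $\sigma$ to $M$ is an antisymmetric assignment $p_{xy}=-p_{yx}$ of real numbers to the edges with $\sum_y p_{xy}=\sigma_x$ for all $x\notin M$. The effective resistance $R_{\sigma,M}$ is the minimum of the energy $\sum_{xy\in E}p_{xy}^2/w_{xy}$ over all unit flows. It is assumed that a unit flow exists. **Walk operator.** Suppose that $G$ is bipartite with parts $A,B$ and that $\sigma$ is supported on $A$. For $\eta,x>0$ let $G'=G'(\eta,x)$ be the graph obtained from $G$ by adding a vertex $s'$, joined to each $u$ with $\sigma_u>0$ by an edge of weight $\sigma_u/\eta$, and for each $k\in M$ a vertex $k'$, joined to $k$ by an edge of weight $1/x$. It is again bipartite, with parts $A'\supseteq A$ and $B'\supseteq B\cup\{s'\}$. On the Hilbert space with one basis state $|xy\rangle$ for each edge of $G'$, a quantum walk step is the unitary $U_{A'}U_{B'}$, where $U_{A'}=\bigoplus_{v\in A'}D_v$ and $U_{B'}=\bigoplus_{v\in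 B'}D_v$. Here $D_v$ is the identity if $v=s'$ or $v=k'$ for some $k\in M$, and otherwise $D_v=I-2|\psi_v\rangle\langle\psi_v|$, where $|\psi_v\rangle=d_v^{-1/2}\sum_{y}\sqrt{w_{vy}}\,|vy\rangle$ and $d_v=\sum_y w_{vy}$ (weights in $G'$). **Algorithms.** A quantum algorithm runs a sequence of circuits. Each circuit has parameters $\eta,x>0$ and acts on the edge space of $G'(\eta,x)$ together with a finite-dimensional ancilla. It starts in a fresh copy of $\sum_u\sqrt{\sigma_u}\,|s'u\rangle$ with the ancilla in a fixed basis state, applies arbitrary ancilla unitaries and ancilla-controlled quantum walk steps, and finally measures both registers in their standard bases. If the measured edge is $kk'$ with $k\in M$, the algorithm outputs $k$ and stops. Otherwise the next circuit is chosen depending on the ancilla outcomes so far. The cost is the number of quantum walk steps plus the number of circuits run. The algorithm may depend only on the given upper bound on the total weight; it has no other information on $G,\sigma,M$, $R_{\sigma,M}$ or $|M|$. **Theorem.** There are a universal constant $C$ and a family of quantum algorithms $(\mathcal A_w)_{w\in\mathbb R}$ such that the following holds for all $G,\sigma,M$ as in the setting and every $\tilde W\ge W$. Put $$T=C\,\max\Bigl\{1,\sqrt{R_{\sigma,M}\tilde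 W}\Bigr\}\,\bigl(1+\log|M|\bigr)^3 .$$ 1. If $G$ is bipartite and $\sigma$ is supported on one part $A$, then $\mathcal A_{\tilde W}$, run on $(G,\sigma,M)$, outputs a marked vertex at cost at most $T$ with probability at least $2/3$. 2. For arbitrary $G$ and $\sigma$, the algorithm $\mathcal A_{2\tilde W}$, run on the bipartite double cover of $G$ (vertices $V\times\{0,1\}$; $(x,0)$ and $(y,1)$ joined with weight $w_{xy}$ for every edge $xy$ of $G$), with marked set $M\times\{0,1\}$ and with $\sigma$ placed on $V\times\{0\}$, outputs a (copy of a) marked vertex at cost at most $T$ with probability at least $2/3$. (If $\sigma$ vanishes on $M$, then $R_{\sigma,M}\tilde W\ge1$, so the maximum is $\sqrt{R_{\sigma,M}\tilde W}$.) -/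

import Mathlib

open scoped Matrix

noncomputable section

/-- A weighted undirected graph on the vertex set `V`, given by its weights; `x` and `y` are joined
by an edge exactly when `w x y ≠ 0`, so edges have positive weight. -/
structure WeightedGraph (V : Type*) where
  w : V → V → ℝ
  symm : ∀ x y, w x y = w y x
  nonneg : ∀ x y, 0 ≤ w x y
  loopless : ∀ x, w x x = 0

namespace WeightedGraph

variable {V : Type*} [Fintype V] (G : WeightedGraph V)

/-- The total weight: the sum of the weights of all (unordered) edges. -/
def totalWeight : ℝ := (∑ x, ∑ y, G.w x y) / 2

/-- The weighted degree of a vertex. -/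
def degree (x : V) : ℝ := ∑ y, G.w x y

/-- Every edge has one endpoint in `A` and the other one outside `A`. -/
def IsBipartition {V : Type*} (G : WeightedGraph V) (A : Set V) : Prop :=
  ∀ x y, G.w x y ≠ 0 → (x ∈ A ↔ y ∉ A)

/-- `p` is a unit flow from `σ` to `M`; `p x y` is the flow from `x` to `y`. -/
structure IsUnitFlow (σ : V → ℝ) (M : Finset V) (p : V → V → ℝ) : Prop where
  antisymm : ∀ x y, p x y = -p y x
  support : ∀ x y, G.w x y = 0 → p x y = 0
  conserve : ∀ x, x ∉ M → ∑ y, p x y = σ x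

/-- The energy of a flow: the sum of `p x y ^ 2 / w x y` over all (unordered) edges. -/
def energy (p : V → V → ℝ) : ℝ := (∑ x, ∑ y, p x y ^ 2 / G.w x y) / 2

/-- The effective resistance between `σ` and `M`: the least energy of a unit flow. -/
def effectiveResistance (σ : V → ℝ) (M : Finset V) : ℝ :=
  sInf {E | ∃ p, G.IsUnitFlow σ M p ∧ E = G.energy p}

/-- The edges of a graph with parts `A` and `Aᶜ`, each written once, in the direction from `A`
to `Aᶜ`. They label the basis states of the Hilbert space of the walk. -/
def Edge {V : Type*} (G : WeightedGraph V) (A : Set V) : Type _ :=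
  {e : V × V // e.1 ∈ A ∧ e.2 ∉ A ∧ G.w e.1 e.2 ≠ 0}

instance (A : Set V) : Fintype (G.Edge A) := by
  classical exact inferInstanceAs (Fintype {e : V × V // e.1 ∈ A ∧ e.2 ∉ A ∧ G.w e.1 e.2 ≠ 0})

instance (A : Set V) : DecidableEq (G.Edge A) := Classical.decEq _

open Classical in
/-- The star state of the vertex `x`: the normalised superposition of the edges at `x`, the edge
`xy` having amplitude `√(w x y) / √(degree x)`. -/
def starState (A : Set V) (x : V) : G.Edge A → ℂ := fun e =>
  if e.1.1 = x ∨ e.1.2 = x then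
    ((Real.sqrt (G.w e.1.1 e.1.2) / Real.sqrt (G.degree x) : ℝ) : ℂ)
  else 0

open Classical in
/-- The direct sum, over the vertices `x` of one part `Q` (`Q = A` or `Q = Aᶜ`), of the diffusion
operators: the identity at the vertices of `S`, and `1 - 2 |ψ⟩⟨ψ|`, `ψ` the star state, at the
others. -/
def reflection (A S Q : Set V) : Matrix (G.Edge A) (G.Edge A) ℂ :=
  1 - (2 : ℂ) • ∑ x : V,
    if x ∈ Q ∧ x ∉ S then Matrix.vecMulVec (G.starState A x) (star (G.starState A x)) else 0

/-- The quantum walk operator `U_A U_B`, with trivial diffusion at the vertices of `S`. -/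
def walkOperator (A S : Set V) : Matrix (G.Edge A) (G.Edge A) ℂ :=
  G.reflection A S A * G.reflection A S Aᶜ

end WeightedGraph

/-- A search problem: a weighted bipartite graph `G` with parts `A` and `Aᶜ`, a set `M` of marked
vertices, and a probability distribution `σ` on the vertices that is supported on `A`. -/
structure SearchProblem (V : Type*) [Fintype V] where
  G : WeightedGraph V
  A : Set V
  bipartite : G.IsBipartition A
  σ : V → ℝ
  isDistribution : σ ∈ stdSimplex ℝ V
  supported : ∀ x, x ∉ A → σ x = 0
  M : Finset V

/-- The vertices of the augmented graph: those of the graph, a start vertex, and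
a leaf for each marked vertex. -/
abbrev AugVertex (V : Type*) (M : Finset V) : Type _ := V ⊕ (Unit ⊕ {k : V // k ∈ M})

namespace SearchProblem

variable {V : Type*} [Fintype V] [DecidableEq V] (P : SearchProblem V)

/-- The effective resistance between the initial distribution and the marked set. -/
def resistance {V : Type*} [Fintype V] (P : SearchProblem V) : ℝ :=
  P.G.effectiveResistance P.σ P.M

/-- The weights of the augmented graph: an edge of weight `σ u / η` between the start vertex and
each `u`, and an edge of weight `1 / x` between each marked vertex and its leaf. -/
def augWeight (η x : ℝ) : AugVertex V P.M → AugVertex V P.M → ℝ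
  | .inl u, .inl v => P.G.w u v
  | .inl u, .inr (.inl _) => P.σ u / η
  | .inr (.inl _), .inl u => P.σ u / η
  | .inl v, .inr (.inr k) => if v = k.1 then 1 / x else 0
  | .inr (.inr k), .inl v => if v = k.1 then 1 / x else 0
  | .inr _, .inr _ => 0

/-- The augmented graph. -/
def augGraph (η x : ℝ) (hη : 0 < η) (hx : 0 < x) : WeightedGraph (AugVertex V P.M) where
  w := P.augWeight η x
  symm := by
    rintro (u | u | u) (v | v | v) <;> simp [augWeight, P.G.symm]
  nonneg := by
    have h := P.isDistribution.1
    rintro (u | u | u) (v | v | v) <;> simp only [augWeight] <;>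
      first
        | exact P.G.nonneg _ _
        | exact div_nonneg (h _) hη.le
        | (split_ifs <;> positivity)
        | exact le_rfl
  loopless := by
    rintro (u | u | u) <;> simp [augWeight, P.G.loopless]

/-- The part of the augmented graph that extends `A`: it contains the leaves of the marked vertices
outside `A`; the start vertex and the other leaves are in the opposite part. -/
def augPart : Set (AugVertex V P.M) :=
  {z | match z with
    | .inl v => v ∈ P.A
    | .inr (.inl _) => False
    | .inr (.inr k) => k.1 ∉ P.A}

/-- The vertices with trivial diffusion: the start vertex and the leaves, the latter being
the marked vertices of the augmented graph. -/
def augSpecial : Set (AugVertex V P.M) := Set.range Sum.inr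

/-- The edges of the augmented graph. -/
abbrev AugEdge (η x : ℝ) (hη : 0 < η) (hx : 0 < x) : Type _ :=
  (P.augGraph η x hη hx).Edge P.augPart

/-- The quantum walk operator of the augmented graph. -/
def augWalk (η x : ℝ) (hη : 0 < η) (hx : 0 < x) :
    Matrix (P.AugEdge η x hη hx) (P.AugEdge η x hη hx) ℂ :=
  (P.augGraph η x hη hx).walkOperator P.augPart P.augSpecial

/-- The initial state: the edge between the start vertex and `u` has amplitude `√(σ u)`. -/
def initialState (η x : ℝ) (hη : 0 < η) (hx : 0 < x) : P.AugEdge η x hη hx → ℂ := fun e =>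
  match e.1 with
  | (.inl u, .inr (.inl _)) => ((Real.sqrt (P.σ u) : ℝ) : ℂ)
  | _ => 0

/-- The marked vertex `k` if the edge joins `k` to its leaf, and `none` for all other edges. -/
def found {η x : ℝ} {hη : 0 < η} {hx : 0 < x} (e : P.AugEdge η x hη hx) : Option V :=
  match e.1 with
  | (.inr (.inr k), _) => some k.1
  | (_, .inr (.inr k)) => some k.1
  | _ => none

end SearchProblem

/-- A gate acting on an ancilla register of dimension `n` and on the edge register: a unitary on
the ancilla alone, or one quantum walk step, controlled on the basis states `j` of the ancilla with
`ctrl j = true`. -/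
inductive Gate (n : ℕ) : Type
  | ancilla (U : Matrix.unitaryGroup (Fin n) ℂ)
  | walk (ctrl : Fin n → Bool)

/-- A quantum circuit on an ancilla register with `n + 1` basis states and the edge register of
the augmented graph with parameters `η` and `x`. No part of it refers to the graph. -/
structure QCircuit where
  η : ℝ
  x : ℝ
  η_pos : 0 < η
  x_pos : 0 < x
  n : ℕ
  gates : List (Gate (n + 1))

namespace Gate

/-- Whether the gate is a quantum walk step. -/
def isWalk {n : ℕ} : Gate n → Bool
  | ancilla _ => false
  | walk _ => true

/-- The action of a gate on a state, for an edge register with basis `E` and walk operator `U`. -/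
def apply {n : ℕ} {E : Type*} [Fintype E] (U : Matrix E E ℂ) (ψ : Fin n × E → ℂ) :
    Gate n → Fin n × E → ℂ
  | ancilla B => fun z => ∑ j, B.1 z.1 j * ψ (j, z.2)
  | walk ctrl => fun z => if ctrl z.1 then ∑ e, U z.2 e * ψ (z.1, e) else ψ z

end Gate

namespace QCircuit

variable {V : Type*} [Fintype V] [DecidableEq V]

/-- The number of quantum walk steps in a circuit. -/
def walkSteps (c : QCircuit) : ℕ := c.gates.countP Gate.isWalk

/-- The cost of running a circuit: its number of quantum walk steps, and one further unit for
preparing its initial state. -/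
def cost (c : QCircuit) : ℕ := c.walkSteps + 1

/-- The final state of a circuit that starts with its ancilla in the basis state `0` and a fresh
copy of the initial state in the edge register. -/
def finalState (c : QCircuit) (P : SearchProblem V) :
    Fin (c.n + 1) × P.AugEdge c.η c.x c.η_pos c.x_pos → ℂ :=
  c.gates.foldl (fun ψ g => g.apply (P.augWalk c.η c.x c.η_pos c.x_pos) ψ)
    (fun z => if z.1 = 0 then P.initialState c.η c.x c.η_pos c.x_pos z.2 else 0)

/-- The probability of seeing the basis states `j` and `e` when the ancilla and the edge
register are measured at the end of the circuit. -/
def outcomeProb (c : QCircuit) (P : SearchProblem V) (j : Fin (c.n + 1))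
    (e : P.AugEdge c.η c.x c.η_pos c.x_pos) : ℝ :=
  ‖c.finalState P (j, e)‖ ^ 2

end QCircuit

/-- A quantum search algorithm with classical control: it runs one circuit after the other and
measures both registers after each. If the measured edge joins a marked vertex to its leaf, the
algorithm stops and outputs this vertex; otherwise it chooses the next circuit from the list of
the ancilla outcomes observed so far. -/
abbrev QAlgorithm : Type := List ℕ → QCircuit

namespace QAlgorithm

variable {V : Type*} [Fintype V] [DecidableEq V]

/-- The probability that, continuing from the list `h` of past outcomes, the algorithm outputs `v`
after running at most `r` more circuits of total cost at most `T`. -/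
def outputProbAux (alg : QAlgorithm) (P : SearchProblem V) (v : V) : ℕ → ℕ → List ℕ → ℝ
  | 0, _, _ => 0
  | r + 1, T, h =>
    if (alg h).cost ≤ T then
      ∑ j, ∑ e, (alg h).outcomeProb P j e *
        (match P.found e with
          | some k => if k = v then 1 else 0
          | none => outputProbAux alg P v r (T - (alg h).cost) (h ++ [j.1]))
    else 0

/-- The probability that the algorithm outputs `v` at total cost at most `T`. Every circuit costs
at least one, so at most `T` circuits can be run. -/
def outputProb (alg : QAlgorithm) (P : SearchProblem V) (T : ℕ) (v : V) : ℝ :=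
  outputProbAux alg P v T T []

/-- The probability that the algorithm outputs a marked vertex at total cost at most `T`. -/
def successProb (alg : QAlgorithm) (P : SearchProblem V) (T : ℕ) : ℝ :=
  ∑ v ∈ P.M, alg.outputProb P T v

end QAlgorithm

namespace WeightedGraph

/-- The bipartite double cover: `(x, i)` and `(y, j)` are joined, with weight `w x y`, when
`i ≠ j`. -/
def doubleCover {V : Type*} (G : WeightedGraph V) : WeightedGraph (V × Bool) where
  w a b := if a.2 = b.2 then 0 else G.w a.1 b.1
  symm a b := by
    simp only [G.symm a.1 b.1, eq_comm]
  nonneg a b := by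
    split_ifs
    · exact le_rfl
    · exact G.nonneg _ _
  loopless a := by simp

/-- The search problem on the double cover of an arbitrary weighted graph: both copies of a marked
vertex are marked, and the initial distribution is placed on the copy `V × {false}`. -/
def doubleCoverProblem {V : Type*} [Fintype V] (G : WeightedGraph V) (σ : V → ℝ)
    (hσ : σ ∈ stdSimplex ℝ V) (M : Finset V) : SearchProblem (V × Bool) where
  G := G.doubleCover
  A := {a | a.2 = false}
  bipartite := by
    rintro ⟨x, i⟩ ⟨y, j⟩ h
    cases i <;> cases j <;> simp_all [doubleCover]
  σ a := if a.2 = false then σ a.1 else 0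
  isDistribution := by
    refine ⟨fun a => ?_, ?_⟩
    · dsimp only
      split_ifs
      · exact hσ.1 _
      · exact le_rfl
    · rw [Fintype.sum_prod_type]
      simpa using hσ.2
  supported a ha := by
    simpa using fun h => absurd h ha
  M := M ×ˢ Finset.univ

end WeightedGraph

end

/-! ### Unitary matrices -/

open scoped Matrix

noncomputable section

/-! View the augmented graph as an electrical network with the start vertex at potential one and the
leaves at zero, and let `v` be the potential of least energy. By Kirchhoff's law its current, the
flow state, is orthogonal to the star states of all vertices with nontrivial diffusion, so the walk
`U` fixes it. The initial state is `√η` times the flow state plus `(U z - z) / 2` with `‖z‖² ≤ 2ηW +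
2` (`exists_initialState_eq`). Averaging `N` powers of `U` telescopes the second term to norm
`O(√(ηW + 1) / N)`. A circuit that implements the average therefore ends on a leaf edge with
probability at least `(η ∑ v_k² / x) / 2`, the sum over `k ∈ M`, up to a small error
(`le_foundProb_averaging`).

For a single `x` this may be tiny. But let `c(x)` be the least energy. Doubling `x` halves the leaf
energy of a fixed potential, so `c(x) - c(2x)` is at most the leaf energy at `2x`, and the sum over
`x = η 2^s` telescopes. If `η ≥ R`, resistances in series give `c(η) ≥ 1 / (3η)`, while the constant
potential one gives `c(x) ≤ |M| / x`. Over `O(1 + log |M|)` scales the leaf weights thus add up to a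
constant (`one_sixth_le_sum`).

Since `R` and `|M|` are unknown, level `(i, j)` guesses that `R w ≤ 4^i` and that `1 + log |M|` is
at most about `2^j`, at cost `O(2^i 4^j)`. Levels are tried in the order of `i + 3j`. Within a stage
their costs decay like `2^{-j}`, so everything up to the right level costs `O(2^{i + 3j})`; this is
the source of the cubed logarithm. A bound on the resistance of `G` passes to the double cover
because the maximum of a potential over the two copies is an admissible potential on `G`
(`ResistanceLE.doubleCover`). -/

theorem Matrix.one_sub_two_smul_mem_unitaryGroup {n : Type*} [Fintype n] [DecidableEq n]
    {P : Matrix n n ℂ} (hP : Pᴴ = P) (hPP : P * P = P) :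
    1 - (2 : ℂ) • P ∈ Matrix.unitaryGroup n ℂ := by
  have hs : star (1 - (2 : ℂ) • P) = 1 - (2 : ℂ) • P := by
    rw [Matrix.star_eq_conjTranspose]
    simp [hP]
  rw [Matrix.mem_unitaryGroup_iff, hs]
  simp only [sub_mul, mul_sub, one_mul, mul_one, smul_mul_assoc, mul_smul_comm, hPP]
  module

theorem Matrix.sum_norm_sq_mulVec {n : Type*} [Fintype n] [DecidableEq n]
    {U : Matrix n n ℂ} (hU : U ∈ Matrix.unitaryGroup n ℂ) (f : n → ℂ) :
    ∑ i, ‖(U *ᵥ f) i‖ ^ 2 = ∑ i, ‖f i‖ ^ 2 := by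
  have key : ∀ h : n → ℂ, ((∑ i, ‖h i‖ ^ 2 : ℝ) : ℂ) = star h ⬝ᵥ h := by
    intro h
    simp only [dotProduct, Pi.star_apply, RCLike.star_def, Complex.conj_mul']
    push_cast
    rfl
  apply Complex.ofReal_injective
  rw [key, key, Matrix.star_mulVec, Matrix.dotProduct_mulVec, Matrix.vecMul_vecMul,
    ← Matrix.star_eq_conjTranspose, Matrix.mem_unitaryGroup_iff'.1 hU, Matrix.vecMul_one]

/-! ### The two reflections of the walk -/

namespace WeightedGraph

variable {V : Type*} [Fintype V] (G : WeightedGraph V)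

open Classical in
theorem sum_edge {R : Type*} [AddCommMonoid R] (A : Set V) (F : V → V → R) :
    ∑ e : G.Edge A, F e.1.1 e.1.2 =
      ∑ x, ∑ y, if x ∈ A ∧ y ∉ A ∧ G.w x y ≠ 0 then F x y else 0 := by
  rw [← Fintype.sum_prod_type' (f := fun x y => if x ∈ A ∧ y ∉ A ∧ G.w x y ≠ 0 then F x y else 0),
    ← Finset.sum_filter]
  refine Finset.sum_bij (fun e _ => e.1) ?_ ?_ ?_ ?_
  · intro e _
    simpa using e.2
  · intro e _ e' _ h
    exact Subtype.ext h
  · intro b hb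
    exact ⟨⟨b, by simpa using hb⟩, Finset.mem_univ _, rfl⟩
  · intro e _
    rfl

open Classical in
theorem sum_edge_fst {A : Set V} (hA : G.IsBipartition A) {x : V} (hx : x ∈ A) (F : V → V → ℝ) :
    ∑ e : G.Edge A, (if e.1.1 = x then G.w e.1.1 e.1.2 * F e.1.1 e.1.2 else 0) =
      ∑ y, G.w x y * F x y := by
  rw [G.sum_edge A fun a b => if a = x then G.w a b * F a b else 0, Finset.sum_eq_single x]
  · refine Finset.sum_congr rfl fun y _ => ?_
    by_cases h : G.w x y = 0
    · simp [h]
    · simp [h, hx, (hA x y h).1 hx]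
  · intro b _ hb
    simp [hb]
  · simp

open Classical in
theorem sum_edge_snd {A : Set V} (hA : G.IsBipartition A) {x : V} (hx : x ∉ A) (F : V → V → ℝ) :
    ∑ e : G.Edge A, (if e.1.2 = x then G.w e.1.1 e.1.2 * F e.1.1 e.1.2 else 0) =
      ∑ y, G.w x y * F y x := by
  rw [G.sum_edge A fun a b => if b = x then G.w a b * F a b else 0, Finset.sum_comm,
    Finset.sum_eq_single x]
  · refine Finset.sum_congr rfl fun y _ => ?_
    rw [G.symm x y]
    by_cases h : G.w y x = 0
    · simp [h]
    · have := (hA y x h).2 hx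
      simp [h, hx, this]
  · intro b _ hb
    simp [hb]
  · simp

open Classical in
/-- The endpoint of an edge in the part `Q`. -/
def endpoint {V : Type*} (G : WeightedGraph V) {A : Set V} (Q : Set V) (e : G.Edge A) : V :=
  if e.1.1 ∈ Q then e.1.1 else e.1.2

theorem endpoint_self {V : Type*} (G : WeightedGraph V) {A : Set V} (e : G.Edge A) :
    G.endpoint A e = e.1.1 := by
  simp [endpoint, e.2.1]

theorem endpoint_compl {V : Type*} (G : WeightedGraph V) {A : Set V} (e : G.Edge A) :
    G.endpoint Aᶜ e = e.1.2 := by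
  simp [endpoint, e.2.1]

theorem endpoint_mem {V : Type*} (G : WeightedGraph V) {A Q : Set V} (hQ : Q = A ∨ Q = Aᶜ)
    (e : G.Edge A) :
    G.endpoint Q e ∈ Q := by
  rcases hQ with rfl | rfl
  · rw [endpoint_self]; exact e.2.1
  · rw [endpoint_compl]; exact e.2.2.1

theorem incident_iff {V : Type*} (G : WeightedGraph V) {A Q : Set V} (hQ : Q = A ∨ Q = Aᶜ)
    (e : G.Edge A) {x : V} (hx : x ∈ Q) :
    (e.1.1 = x ∨ e.1.2 = x) ↔ G.endpoint Q e = x := by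
  rcases hQ with rfl | rfl
  · rw [endpoint_self]
    refine ⟨?_, Or.inl⟩
    rintro (h | h)
    · exact h
    · exact absurd hx (h ▸ e.2.2.1)
  · rw [endpoint_compl]
    refine ⟨?_, Or.inr⟩
    rintro (h | h)
    · exact absurd e.2.1 (h ▸ hx)
    · exact h

theorem weight_pos {V : Type*} (G : WeightedGraph V) {A : Set V} (e : G.Edge A) :
    0 < G.w e.1.1 e.1.2 :=
  lt_of_le_of_ne (G.nonneg _ _) (Ne.symm e.2.2.2)

theorem degree_endpoint_pos {A : Set V} (Q : Set V) (e : G.Edge A) :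
    0 < G.degree (G.endpoint Q e) := by
  unfold endpoint degree
  split_ifs
  · exact Finset.sum_pos' (fun _ _ => G.nonneg _ _) ⟨e.1.2, Finset.mem_univ _, G.weight_pos e⟩
  · refine Finset.sum_pos' (fun _ _ => G.nonneg _ _) ⟨e.1.1, Finset.mem_univ _, ?_⟩
    rw [G.symm]
    exact G.weight_pos e

open Classical in
theorem sum_edge_endpoint {A Q : Set V} (hQ : Q = A ∨ Q = Aᶜ) (hA : G.IsBipartition A) {x : V}
    (hx : x ∈ Q) :
    ∑ e : G.Edge A, (if G.endpoint Q e = x then G.w e.1.1 e.1.2 else 0) = G.degree x := by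
  rcases hQ with rfl | rfl
  · simp only [endpoint_self]
    simpa [degree] using G.sum_edge_fst hA hx fun _ _ => 1
  · simp only [endpoint_compl]
    simpa [degree] using G.sum_edge_snd hA hx fun _ _ => 1

open Classical in
/-- The projection onto the span of the star states of the vertices in `Q \ S`. -/
def starProj (A S Q : Set V) : Matrix (G.Edge A) (G.Edge A) ℂ := fun e e' =>
  if G.endpoint Q e = G.endpoint Q e' ∧ G.endpoint Q e ∉ S then
    ((√(G.w e.1.1 e.1.2) * √(G.w e'.1.1 e'.1.2) / G.degree (G.endpoint Q e) : ℝ) : ℂ)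
  else 0

-- Each edge has exactly one endpoint in `Q`, so the star states have disjoint supports and at most
-- one vertex contributes to a given matrix entry.
open Classical in
theorem reflection_eq {A Q : Set V} (S : Set V) (hQ : Q = A ∨ Q = Aᶜ) :
    G.reflection A S Q = 1 - (2 : ℂ) • G.starProj A S Q := by
  unfold reflection
  congr 2
  ext e e'
  rw [Matrix.sum_apply]
  have : ∀ x : V, (if x ∈ Q ∧ x ∉ S then
      Matrix.vecMulVec (G.starState A x) (star (G.starState A x)) else 0) e e' =
      if G.endpoint Q e = x then G.starProj A S Q e e' else 0 := by
    intro x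
    by_cases hx : x ∈ Q
    · by_cases hS : x ∈ S
      · simp only [hS, not_true, and_false, if_false, Matrix.zero_apply]
        split_ifs with h
        · simp [starProj, h, hS]
        · rfl
      · simp only [hx, hS, not_false_eq_true, and_self, if_true, Matrix.vecMulVec_apply,
          Pi.star_apply, starState, G.incident_iff hQ _ hx]
        by_cases h : G.endpoint Q e = x
        · by_cases h' : G.endpoint Q e' = x
          · have hd : √(G.degree x) * √(G.degree x) = G.degree x := by
              rw [Real.mul_self_sqrt]
              exact Finset.sum_nonneg fun _ _ => G.nonneg _ _
            simp only [h, h', starProj, if_true, RCLike.star_def, Complex.conj_ofReal, hS,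
              not_false_eq_true, and_self]
            rw [← Complex.ofReal_mul, div_mul_div_comm, hd]
          · have h'' : x ≠ G.endpoint Q e' := Ne.symm h'
            simp [h, h', h'', starProj]
        · simp [h]
    · have h : G.endpoint Q e ≠ x := fun h => hx (h ▸ G.endpoint_mem hQ e)
      simp [hx, h]
  simp only [this]
  simp

theorem starProj_conjTranspose (A S Q : Set V) : (G.starProj A S Q)ᴴ = G.starProj A S Q := by
  ext e e'
  simp only [Matrix.conjTranspose_apply, starProj]
  by_cases h : G.endpoint Q e = G.endpoint Q e'
  · by_cases hS : G.endpoint Q e' ∈ S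
    · simp [h, hS]
    · simp [h, hS, mul_comm]
  · simp [h, Ne.symm h]

theorem starProj_mul_self {A Q : Set V} (S : Set V) (hQ : Q = A ∨ Q = Aᶜ)
    (hA : G.IsBipartition A) : G.starProj A S Q * G.starProj A S Q = G.starProj A S Q := by
  classical
  ext e e'
  rw [Matrix.mul_apply]
  by_cases hS : G.endpoint Q e ∈ S
  · simp [starProj, hS]
  by_cases h : G.endpoint Q e = G.endpoint Q e'
  · have hd := G.degree_endpoint_pos Q e
    have : ∀ f : G.Edge A, G.starProj A S Q e f * G.starProj A S Q f e' =
        (((if G.endpoint Q f = G.endpoint Q e then G.w f.1.1 f.1.2 else 0) *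
          (√(G.w e.1.1 e.1.2) * √(G.w e'.1.1 e'.1.2) / G.degree (G.endpoint Q e) ^ 2) : ℝ) :
          ℂ) := by
      intro f
      by_cases hf : G.endpoint Q f = G.endpoint Q e
      · have hw : √(G.w f.1.1 f.1.2) * √(G.w f.1.1 f.1.2) = G.w f.1.1 f.1.2 :=
          Real.mul_self_sqrt (G.nonneg _ _)
        simp only [starProj, hf, hS, ← h, not_false_eq_true, and_self, if_true,
          ← Complex.ofReal_mul]
        congr 1
        rw [div_mul_div_comm, show √(G.w e.1.1 e.1.2) * √(G.w f.1.1 f.1.2) *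
          (√(G.w f.1.1 f.1.2) * √(G.w e'.1.1 e'.1.2)) = (√(G.w f.1.1 f.1.2) * √(G.w f.1.1 f.1.2)) *
          (√(G.w e.1.1 e.1.2) * √(G.w e'.1.1 e'.1.2)) by ring, hw]
        ring
      · simp [starProj, hf, Ne.symm hf]
    simp only [this]
    rw [← Complex.ofReal_sum, ← Finset.sum_mul,
      G.sum_edge_endpoint hQ hA (G.endpoint_mem hQ e)]
    simp only [starProj, ← h, hS, not_false_eq_true, and_self, if_true]
    congr 1
    field_simp
  · have hz : ∀ f, G.starProj A S Q e f * G.starProj A S Q f e' = 0 := by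
      intro f
      by_cases hf : G.endpoint Q e = G.endpoint Q f
      · simp [starProj, ← hf, h]
      · simp [starProj, hf]
    rw [Finset.sum_eq_zero fun f _ => hz f]
    simp [starProj, h]

theorem reflection_mem_unitaryGroup {A Q : Set V} (S : Set V) (hQ : Q = A ∨ Q = Aᶜ)
    (hA : G.IsBipartition A) : G.reflection A S Q ∈ Matrix.unitaryGroup (G.Edge A) ℂ := by
  rw [G.reflection_eq S hQ]
  exact Matrix.one_sub_two_smul_mem_unitaryGroup (G.starProj_conjTranspose A S Q)
    (G.starProj_mul_self S hQ hA)

theorem walkOperator_mem_unitaryGroup {A : Set V} (S : Set V) (hA : G.IsBipartition A) :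
    G.walkOperator A S ∈ Matrix.unitaryGroup (G.Edge A) ℂ :=
  mul_mem (G.reflection_mem_unitaryGroup S (Or.inl rfl) hA)
    (G.reflection_mem_unitaryGroup S (Or.inr rfl) hA)

open Classical in
/-- A vector orthogonal to all star states in `Q \ S` is fixed by the reflection. -/
theorem reflection_mulVec_eq_self {A Q : Set V} {S : Set V} (hQ : Q = A ∨ Q = Aᶜ)
    (f : G.Edge A → ℝ)
    (hf : ∀ x ∈ Q, x ∉ S →
      ∑ e : G.Edge A, (if G.endpoint Q e = x then √(G.w e.1.1 e.1.2) * f e else 0) = 0) :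
    G.reflection A S Q *ᵥ (fun e => (f e : ℂ)) = fun e => (f e : ℂ) := by
  rw [G.reflection_eq S hQ, Matrix.sub_mulVec, Matrix.one_mulVec, Matrix.smul_mulVec]
  have : G.starProj A S Q *ᵥ (fun e => (f e : ℂ)) = 0 := by
    ext e
    simp only [Matrix.mulVec, dotProduct, Pi.zero_apply]
    by_cases hS : G.endpoint Q e ∈ S
    · simp [starProj, hS]
    have h := hf _ (G.endpoint_mem hQ e) hS
    have h2 : ∀ e', G.starProj A S Q e e' * (f e' : ℂ) =
        ((√(G.w e.1.1 e.1.2) / G.degree (G.endpoint Q e) *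
          (if G.endpoint Q e' = G.endpoint Q e then √(G.w e'.1.1 e'.1.2) * f e' else 0) : ℝ) :
          ℂ) := by
      intro e'
      by_cases he : G.endpoint Q e' = G.endpoint Q e
      · simp only [starProj, he, hS, not_false_eq_true, and_self, if_true, ← Complex.ofReal_mul]
        congr 1
        ring
      · simp [starProj, he, Ne.symm he]
    simp only [h2]
    rw [← Complex.ofReal_sum, ← Finset.mul_sum, h]
    simp
  rw [this, smul_zero, sub_zero]

/-- A combination of star states in `Q \ S` is negated by the reflection. -/
theorem reflection_mulVec_eq_neg {A Q : Set V} {S : Set V} (hQ : Q = A ∨ Q = Aᶜ)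
    (hA : G.IsBipartition A) (u : V → ℝ) (hu : ∀ x ∈ S, u x = 0) :
    G.reflection A S Q *ᵥ (fun e => ((√(G.w e.1.1 e.1.2) * u (G.endpoint Q e) : ℝ) : ℂ)) =
      -fun e => ((√(G.w e.1.1 e.1.2) * u (G.endpoint Q e) : ℝ) : ℂ) := by
  classical
  rw [G.reflection_eq S hQ, Matrix.sub_mulVec, Matrix.one_mulVec, Matrix.smul_mulVec]
  have : G.starProj A S Q *ᵥ (fun e => ((√(G.w e.1.1 e.1.2) * u (G.endpoint Q e) : ℝ) : ℂ)) =
      fun e => ((√(G.w e.1.1 e.1.2) * u (G.endpoint Q e) : ℝ) : ℂ) := by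
    ext e
    simp only [Matrix.mulVec, dotProduct]
    by_cases hS : G.endpoint Q e ∈ S
    · simp [starProj, hS, hu _ hS]
    have hd := G.degree_endpoint_pos Q e
    have h2 : ∀ e' : G.Edge A, G.starProj A S Q e e' *
        ((√(G.w e'.1.1 e'.1.2) * u (G.endpoint Q e') : ℝ) : ℂ) =
        ((√(G.w e.1.1 e.1.2) / G.degree (G.endpoint Q e) * u (G.endpoint Q e) *
          (if G.endpoint Q e' = G.endpoint Q e then G.w e'.1.1 e'.1.2 else 0) : ℝ) : ℂ) := by
      intro e'
      by_cases he : G.endpoint Q e' = G.endpoint Q e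
      · have hw : √(G.w e'.1.1 e'.1.2) * √(G.w e'.1.1 e'.1.2) = G.w e'.1.1 e'.1.2 :=
          Real.mul_self_sqrt (G.nonneg _ _)
        simp only [starProj, he, hS, not_false_eq_true, and_self, if_true, ← Complex.ofReal_mul]
        congr 1
        rw [div_mul_eq_mul_div, div_mul_eq_mul_div, show √(G.w e.1.1 e.1.2) * √(G.w e'.1.1 e'.1.2) *
          (√(G.w e'.1.1 e'.1.2) * u (G.endpoint Q e)) = (√(G.w e'.1.1 e'.1.2) *
          √(G.w e'.1.1 e'.1.2)) * (√(G.w e.1.1 e.1.2) * u (G.endpoint Q e)) by ring, hw]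
        ring
      · simp [starProj, he, Ne.symm he]
    simp only [h2]
    rw [← Complex.ofReal_sum, ← Finset.mul_sum,
      G.sum_edge_endpoint hQ hA (G.endpoint_mem hQ e)]
    congr 1
    field_simp
  rw [this]
  ext e
  simp only [Pi.sub_apply, Pi.smul_apply, smul_eq_mul, Pi.neg_apply]
  ring

end WeightedGraph

/-! ### Elementary inequalities and summation by parts -/

/-- A cross term of Cauchy–Schwarz without square roots: `|a b|` is at most the geometric mean of `p
s` and `q r`. -/
theorem two_mul_mul_le_of_sq_le {a b p q r s : ℝ} (hp : 0 ≤ p) (hq : 0 ≤ q) (hr : 0 ≤ r)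
    (hs : 0 ≤ s) (ha : a ^ 2 ≤ p * r) (hb : b ^ 2 ≤ q * s) : 2 * a * b ≤ p * s + q * r := by
  refine le_trans (le_abs_self _) (abs_le_of_sq_le_sq ?_ (by positivity))
  have h : a ^ 2 * b ^ 2 ≤ (p * r) * (q * s) := mul_le_mul ha hb (sq_nonneg _) (by positivity)
  nlinarith [sq_nonneg (p * s - q * r)]

theorem eq_zero_of_forall_linear_add_sq_nonneg {b d : ℝ}
    (h : ∀ t : ℝ, 0 ≤ 2 * t * b + t ^ 2 * d) : b = 0 := by
  have hd : 0 ≤ d := by linarith [h 1, h (-1)]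
  -- The minimiser is `-b / d`; the shift by one also covers `d = 0`.
  have h1 := h (-b / (d + 1))
  have h2 : 2 * (-b / (d + 1)) * b + (-b / (d + 1)) ^ 2 * d = -(b ^ 2 * (d + 2)) / (d + 1) ^ 2 := by
    field_simp
    ring
  rw [h2, le_div_iff₀ (by positivity)] at h1
  have : b ^ 2 ≤ 0 := by nlinarith [sq_nonneg b]
  exact pow_eq_zero_iff two_ne_zero |>.1 (le_antisymm this (sq_nonneg b))

/-- Nonnegativity of the variance. -/
theorem sq_sum_mul_le_of_mem_stdSimplex {V : Type*} [Fintype V] {σ : V → ℝ}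
    (hσ : σ ∈ stdSimplex ℝ V) (f : V → ℝ) : (∑ u, σ u * f u) ^ 2 ≤ ∑ u, σ u * f u ^ 2 := by
  set μ := ∑ u, σ u * f u with hμ
  have h : 0 ≤ ∑ u, σ u * (f u - μ) ^ 2 :=
    Finset.sum_nonneg fun u _ => mul_nonneg (hσ.1 u) (sq_nonneg _)
  have e : ∑ u, σ u * (f u - μ) ^ 2 = ∑ u, σ u * f u ^ 2 - 2 * μ * ∑ u, σ u * f u
      + μ ^ 2 * ∑ u, σ u := by
    rw [Finset.mul_sum (a := 2 * μ), Finset.mul_sum (a := μ ^ 2), ← Finset.sum_sub_distrib,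
      ← Finset.sum_add_distrib]
    exact Finset.sum_congr rfl fun u _ => by ring
  rw [e, hσ.2, ← hμ] at h
  nlinarith

theorem sum_mul_sum_of_antisymm {V : Type*} [Fintype V] {a : V → V → ℝ}
    (ha : ∀ x y, a x y = -a y x) (φ : V → ℝ) :
    ∑ x, φ x * ∑ y, a x y = (∑ x, ∑ y, a x y * (φ x - φ y)) / 2 := by
  have h1 : ∑ x, φ x * ∑ y, a x y = ∑ x, ∑ y, a x y * φ x := by
    simp only [Finset.mul_sum, mul_comm]
  have h2 : ∑ x, ∑ y, a x y * φ y = -∑ x, ∑ y, a x y * φ x := by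
    rw [Finset.sum_comm, ← Finset.sum_neg_distrib]
    refine Finset.sum_congr rfl fun x _ => ?_
    rw [← Finset.sum_neg_distrib]
    exact Finset.sum_congr rfl fun y _ => by rw [ha y x]; ring
  simp only [mul_sub, Finset.sum_sub_distrib]
  rw [h1, h2]
  ring

/-! ### Dual bounds on the effective resistance -/

namespace WeightedGraph

variable {V : Type*} [Fintype V] (G : WeightedGraph V)

theorem totalWeight_nonneg : 0 ≤ G.totalWeight :=
  div_nonneg (Finset.sum_nonneg fun _ _ => Finset.sum_nonneg fun _ _ => G.nonneg _ _) two_pos.le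

/-- The Dirichlet energy of a potential. -/
def dirichlet (φ : V → ℝ) : ℝ := (∑ x, ∑ y, G.w x y * (φ x - φ y) ^ 2) / 2

theorem dirichlet_nonneg (φ : V → ℝ) : 0 ≤ G.dirichlet φ :=
  div_nonneg (Finset.sum_nonneg fun _ _ => Finset.sum_nonneg fun _ _ =>
    mul_nonneg (G.nonneg _ _) (sq_nonneg _)) two_pos.le

theorem dirichlet_mono {φ ψ : V → ℝ} (h : ∀ x y, |φ x - φ y| ≤ |ψ x - ψ y|) :
    G.dirichlet φ ≤ G.dirichlet ψ := by
  exact div_le_div_of_nonneg_right (Finset.sum_le_sum fun x _ => Finset.sum_le_sum fun y _ =>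
    mul_le_mul_of_nonneg_left (sq_le_sq.2 (h x y)) (G.nonneg _ _)) two_pos.le

theorem dirichlet_add_smul (v φ : V → ℝ) (t : ℝ) :
    G.dirichlet (v + t • φ) = G.dirichlet v +
      2 * t * (∑ x, φ x * ∑ y, G.w x y * (v x - v y)) + t ^ 2 * G.dirichlet φ := by
  have ha : ∀ x y, G.w x y * (v x - v y) = -(G.w y x * (v y - v x)) := fun x y => by
    rw [G.symm x y]; ring
  rw [sum_mul_sum_of_antisymm ha φ]
  unfold dirichlet
  rw [show ∀ A B C : ℝ, A / 2 + 2 * t * (B / 2) + t ^ 2 * (C / 2) =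
    (A + 2 * t * B + t ^ 2 * C) / 2 by intros; ring]
  congr 1
  simp only [Finset.mul_sum, ← Finset.sum_add_distrib, Pi.add_apply, Pi.smul_apply, smul_eq_mul]
  exact Finset.sum_congr rfl fun x _ => Finset.sum_congr rfl fun y _ => by ring

/-- The dual description of an upper bound `R` on the effective resistance. -/
def ResistanceLE (σ : V → ℝ) (M : Finset V) (R : ℝ) : Prop :=
  0 ≤ R ∧ ∀ φ : V → ℝ, (∀ k ∈ M, φ k = 0) → (∑ u, σ u * φ u) ^ 2 ≤ R * G.dirichlet φ

variable {G} {σ : V → ℝ} {M : Finset V}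

theorem energy_nonneg (p : V → V → ℝ) : 0 ≤ G.energy p :=
  div_nonneg (Finset.sum_nonneg fun _ _ => Finset.sum_nonneg fun _ _ =>
    div_nonneg (sq_nonneg _) (G.nonneg _ _)) two_pos.le

/-- Weak duality: summation by parts turns the left side into a pairing of the flow with the
gradient of `φ`, to which Cauchy–Schwarz applies. The marked vertices, where the flow is
unconstrained, drop out because `φ` vanishes there. -/
theorem IsUnitFlow.sq_sum_le {p : V → V → ℝ} (hp : G.IsUnitFlow σ M p) {φ : V → ℝ}
    (hφ : ∀ k ∈ M, φ k = 0) : (∑ u, σ u * φ u) ^ 2 ≤ G.energy p * G.dirichlet φ := by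
  have h1 : ∑ u, σ u * φ u = (∑ x, ∑ y, p x y * (φ x - φ y)) / 2 := by
    rw [← sum_mul_sum_of_antisymm hp.antisymm]
    refine Finset.sum_congr rfl fun x _ => ?_
    by_cases hx : x ∈ M
    · simp [hφ x hx]
    · rw [hp.conserve x hx, mul_comm]
  have h2 : ∀ x y, p x y * (φ x - φ y) = (p x y / √(G.w x y)) * (√(G.w x y) * (φ x - φ y)) := by
    intro x y
    by_cases h : G.w x y = 0
    · simp [hp.support x y h]
    · have : √(G.w x y) ≠ 0 := Real.sqrt_ne_zero'.2 (lt_of_le_of_ne (G.nonneg _ _) (Ne.symm h))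
      field_simp
  have h3 := Finset.sum_mul_sq_le_sq_mul_sq (Finset.univ : Finset (V × V))
    (fun z => p z.1 z.2 / √(G.w z.1 z.2)) fun z => √(G.w z.1 z.2) * (φ z.1 - φ z.2)
  simp only [Fintype.sum_prod_type, div_pow, mul_pow, Real.sq_sqrt (G.nonneg _ _), ← h2] at h3
  rw [h1]
  unfold energy dirichlet
  nlinarith

/-- Only weak duality is needed, so the infimum need not be attained: the bound holds for each flow
and passes to the infimum. -/
theorem IsUnitFlow.resistanceLE {p : V → V → ℝ} (hp : G.IsUnitFlow σ M p) :
    G.ResistanceLE σ M (G.effectiveResistance σ M) := by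
  refine ⟨Real.sInf_nonneg ?_, fun φ hφ => ?_⟩
  · rintro _ ⟨q, _, rfl⟩
    exact energy_nonneg q
  -- If the Dirichlet energy is zero there is nothing to divide by, but the given flow already
  -- forces the left side to vanish.
  rcases (G.dirichlet_nonneg φ).eq_or_lt with h0 | h0
  · rw [← h0, mul_zero]
    have := hp.sq_sum_le hφ
    rwa [← h0, mul_zero] at this
  · rw [← div_le_iff₀ h0]
    refine le_csInf ⟨_, p, hp, rfl⟩ ?_
    rintro _ ⟨q, hq, rfl⟩
    rw [div_le_iff₀ h0]
    exact hq.sq_sum_le hφ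

/-- Without edges every flow is zero. This serves the case of a nonpositive weight bound, which the
algorithm replaces by one. -/
theorem effectiveResistance_eq_zero_of_totalWeight_eq_zero (h : G.totalWeight = 0)
    {p : V → V → ℝ} (hp : G.IsUnitFlow σ M p) : G.effectiveResistance σ M = 0 := by
  refine le_antisymm ?_ hp.resistanceLE.1
  have hw : ∀ x y, G.w x y = 0 := by
    have h1 : ∑ x, ∑ y, G.w x y = 0 := by unfold totalWeight at h; linarith
    intro x y
    rw [Finset.sum_eq_zero_iff_of_nonneg fun _ _ => Finset.sum_nonneg fun _ _ => G.nonneg _ _] at h1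
    have h2 := h1 x (Finset.mem_univ _)
    rw [Finset.sum_eq_zero_iff_of_nonneg fun _ _ => G.nonneg _ _] at h2
    exact h2 y (Finset.mem_univ _)
  refine csInf_le ⟨0, ?_⟩ ⟨p, hp, ?_⟩
  · rintro _ ⟨q, _, rfl⟩
    exact energy_nonneg q
  · simp [energy, hp.support _ _ (hw _ _)]

/-- By antisymmetry the net outflows add up to zero, whereas `σ` has mass one. -/
theorem IsUnitFlow.nonempty_marked {p : V → V → ℝ} (hp : G.IsUnitFlow σ M p)
    (hσ : σ ∈ stdSimplex ℝ V) : M.Nonempty := by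
  rw [Finset.nonempty_iff_ne_empty]
  rintro rfl
  have h := sum_mul_sum_of_antisymm hp.antisymm fun _ => 1
  have h2 : ∀ x, ∑ y, p x y = σ x := fun x => hp.conserve x (Finset.notMem_empty x)
  simp [h2, hσ.2] at h

theorem totalWeight_doubleCover : G.doubleCover.totalWeight = 2 * G.totalWeight := by
  simp only [totalWeight, doubleCover, Fintype.sum_prod_type, Fintype.sum_bool]
  simp only [Finset.sum_add_distrib, reduceCtorEq, if_false, if_true]
  ring_nf
  simp

/-- The crosswise pairing matches the two edges of the double cover above an edge of the graph. -/
theorem max_sub_max_sq_le (a b c d : ℝ) :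
    (max a b - max c d) ^ 2 ≤ (a - d) ^ 2 + (b - c) ^ 2 := by
  have h : |max a b - max d c| ≤ max |a - d| |b - c| := abs_max_sub_max_le_max a b d c
  rw [max_comm d c] at h
  rcases le_max_iff.1 h with h | h <;> have := sq_le_sq.2 h <;> nlinarith [sq_nonneg (a - d),
    sq_nonneg (b - c)]

/-- The dual form avoids lifting a flow to the cover. The maximum `ψ` of `φ` over the two copies has
no more energy than `φ` and dominates `φ` on the copy carrying `σ`; `ψ'` does the same for `-φ` and
handles a negative mean. -/
theorem ResistanceLE.doubleCover {R : ℝ} (h : G.ResistanceLE σ M R) (hσ : σ ∈ stdSimplex ℝ V) :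
    (G.doubleCoverProblem σ hσ M).G.ResistanceLE (G.doubleCoverProblem σ hσ M).σ
      (G.doubleCoverProblem σ hσ M).M R := by
  refine ⟨h.1, fun φ hφ => ?_⟩
  simp only [doubleCoverProblem] at hφ ⊢
  simp only [Fintype.sum_prod_type, Fintype.sum_bool]
  simp only [reduceCtorEq, if_false, if_true, zero_mul, zero_add]
  set ψ : V → ℝ := fun x => max (φ (x, false)) (φ (x, true)) with hψ
  set ψ' : V → ℝ := fun x => max (-φ (x, false)) (-φ (x, true)) with hψ'
  have hD : G.doubleCover.dirichlet φ =
      (∑ x, ∑ y, G.w x y * ((φ (x, false) - φ (y, true)) ^ 2 +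
        (φ (x, true) - φ (y, false)) ^ 2)) / 2 := by
    simp only [dirichlet, WeightedGraph.doubleCover, Fintype.sum_prod_type, Fintype.sum_bool]
    simp only [reduceCtorEq, if_false, if_true, zero_mul, zero_add, add_zero]
    congr 1
    refine Finset.sum_congr rfl fun x _ => ?_
    rw [← Finset.sum_add_distrib]
    exact Finset.sum_congr rfl fun y _ => by ring
  have hM : ∀ k ∈ M, ∀ i, φ (k, i) = 0 := fun k hk i => hφ (k, i) (by simp [hk])
  have h1 := h.2 ψ fun k hk => by simp [hψ, hM k hk]
  have h2 := h.2 ψ' fun k hk => by simp [hψ', hM k hk]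
  have d1 : G.dirichlet ψ ≤ G.doubleCover.dirichlet φ := by
    rw [hD]
    unfold dirichlet
    gcongr with x _ y _
    · exact G.nonneg _ _
    · exact max_sub_max_sq_le _ _ _ _
  have d2 : G.dirichlet ψ' ≤ G.doubleCover.dirichlet φ := by
    rw [hD]
    unfold dirichlet
    gcongr with x _ y _
    · exact G.nonneg _ _
    · refine (max_sub_max_sq_le _ _ _ _).trans (le_of_eq ?_)
      ring
  have s1 : ∑ u, σ u * φ (u, false) ≤ ∑ u, σ u * ψ u :=
    Finset.sum_le_sum fun u _ => mul_le_mul_of_nonneg_left (le_max_left _ _) (hσ.1 u)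
  have s2 : -∑ u, σ u * φ (u, false) ≤ ∑ u, σ u * ψ' u := by
    rw [← Finset.sum_neg_distrib]
    refine Finset.sum_le_sum fun u _ => ?_
    rw [← mul_neg]
    exact mul_le_mul_of_nonneg_left (le_max_left _ _) (hσ.1 u)
  rcases le_total 0 (∑ u, σ u * φ (u, false)) with h0 | h0
  · exact (pow_le_pow_left₀ h0 s1 2).trans (h1.trans (mul_le_mul_of_nonneg_left d1 h.1))
  · rw [← neg_sq]
    exact (pow_le_pow_left₀ (neg_nonneg.2 h0) s2 2).trans
      (h2.trans (mul_le_mul_of_nonneg_left d2 h.1))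

/-! ### Energy-minimising potentials on the augmented graph -/

variable (G σ M)

/-- The Dirichlet energy, in the augmented graph, of the extension of `v` by the value `1` at the
start vertex and `0` at the leaves. -/
def augEnergy (η x : ℝ) (v : V → ℝ) : ℝ :=
  G.dirichlet v + ∑ u, σ u / η * (1 - v u) ^ 2 + ∑ k ∈ M, v k ^ 2 / x

/-- A potential with values in `[0, 1]` of least energy in the augmented graph. -/
structure IsAugPotential (η x : ℝ) (v : V → ℝ) : Prop where
  nonneg : ∀ u, 0 ≤ v u
  le_one : ∀ u, v u ≤ 1
  minimal : ∀ v', G.augEnergy σ M η x v ≤ G.augEnergy σ M η x v'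

variable {G σ M}

/-- A minimiser exists on the cube by compactness. It is a global minimiser because truncating a
potential to `[0, 1]` is 1-Lipschitz and fixes the boundary values, so it does not raise the energy.
-/
theorem exists_isAugPotential (hσ : σ ∈ stdSimplex ℝ V) {η x : ℝ} (hη : 0 < η) (hx : 0 < x) :
    ∃ v, G.IsAugPotential σ M η x v := by
  have hc : Continuous (G.augEnergy σ M η x) := by
    unfold augEnergy dirichlet
    fun_prop
  obtain ⟨v, hv, hmin⟩ := (isCompact_Icc (a := (0 : V → ℝ)) (b := 1)).exists_isMinOn
    ⟨0, by simp⟩ hc.continuousOn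
  refine ⟨v, fun u => hv.1 u, fun u => hv.2 u, fun v' => ?_⟩
  set c : V → ℝ := fun u => max 0 (min 1 (v' u)) with hcdef
  have hcmem : c ∈ Set.Icc (0 : V → ℝ) 1 :=
    ⟨fun u => le_max_left _ _, fun u => max_le zero_le_one (min_le_left _ _)⟩
  refine le_trans (hmin hcmem) ?_
  have hlip : ∀ a b : ℝ, |max 0 (min 1 a) - max 0 (min 1 b)| ≤ |a - b| := by
    intro a b
    have h1 := abs_max_sub_max_le_max 0 (min 1 a) 0 (min 1 b)
    have h2 := abs_min_sub_min_le_max 1 a 1 b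
    simp only [sub_self, abs_zero] at h1 h2
    refine h1.trans (max_le (abs_nonneg _) (h2.trans (max_le (abs_nonneg _) le_rfl)))
  refine add_le_add (add_le_add (G.dirichlet_mono fun a b => hlip _ _)
    (Finset.sum_le_sum fun u _ => mul_le_mul_of_nonneg_left (sq_le_sq.2 ?_)
      (div_nonneg (hσ.1 u) hη.le)))
    (Finset.sum_le_sum fun k _ => div_le_div_of_nonneg_right (sq_le_sq.2 ?_) hx.le)
  · simpa using hlip 1 (v' u)
  · simpa using hlip (v' k) 0

-- The first variation of the energy in the direction of the indicator of `u` vanishes.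
open Classical in
theorem IsAugPotential.harmonic {η x : ℝ} {v : V → ℝ} (hv : G.IsAugPotential σ M η x v) (u : V) :
    ∑ y, G.w u y * (v u - v y) + σ u / η * (v u - 1) + (if u ∈ M then v u / x else 0) = 0 := by
  set φ : V → ℝ := Pi.single u 1 with hφ
  refine eq_zero_of_forall_linear_add_sq_nonneg
    (d := G.dirichlet φ + ∑ y, σ y / η * φ y ^ 2 + ∑ k ∈ M, φ k ^ 2 / x) fun t => ?_
  have h := hv.minimal (v + t • φ)
  unfold augEnergy at h
  rw [dirichlet_add_smul] at h
  have e0 : ∀ f : V → ℝ, ∑ y, φ y * f y = f u := fun f => by simp [hφ, Pi.single_apply]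
  have e1 : ∑ y, σ y / η * (1 - (v + t • φ) y) ^ 2 = ∑ y, σ y / η * (1 - v y) ^ 2 +
      2 * t * (σ u / η * (v u - 1)) + t ^ 2 * ∑ y, σ y / η * φ y ^ 2 := by
    rw [← e0 fun y => σ y / η * (v y - 1)]
    simp only [Finset.mul_sum, ← Finset.sum_add_distrib, Pi.add_apply, Pi.smul_apply, smul_eq_mul]
    exact Finset.sum_congr rfl fun y _ => by ring
  have e2 : ∑ k ∈ M, (v + t • φ) k ^ 2 / x = ∑ k ∈ M, v k ^ 2 / x +
      2 * t * (if u ∈ M then v u / x else 0) + t ^ 2 * ∑ k ∈ M, φ k ^ 2 / x := by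
    have : (if u ∈ M then v u / x else 0) = ∑ k ∈ M, φ k * (v k / x) := by
      simp [hφ, Pi.single_apply]
    rw [this]
    simp only [Finset.mul_sum, ← Finset.sum_add_distrib, Pi.add_apply, Pi.smul_apply, smul_eq_mul]
    exact Finset.sum_congr rfl fun y _ => by ring
  rw [e1, e2, e0] at h
  linarith

theorem IsAugPotential.augEnergy_le (hσ : σ ∈ stdSimplex ℝ V) {η x : ℝ} {v : V → ℝ}
    (hv : G.IsAugPotential σ M η x v) : G.augEnergy σ M η x v ≤ 1 / η := by
  refine (hv.minimal 0).trans (le_of_eq ?_)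
  simp [augEnergy, dirichlet, ← Finset.sum_div, hσ.2]

theorem IsAugPotential.augEnergy_le_card_div {η x : ℝ} {v : V → ℝ}
    (hv : G.IsAugPotential σ M η x v) : G.augEnergy σ M η x v ≤ M.card / x := by
  refine (hv.minimal 1).trans (le_of_eq ?_)
  simp [augEnergy, dirichlet, div_eq_mul_inv]

/-- Resistances in series: the unit drop of potential splits into a drop at the start edges, one
inside the graph and one at a leaf, controlled by `η`, `R` and `x` times the respective energies.
Cauchy–Schwarz combines the three. -/
theorem ResistanceLE.one_le_mul_augEnergy {R : ℝ} (hR : G.ResistanceLE σ M R)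
    (hσ : σ ∈ stdSimplex ℝ V) (hM : M.Nonempty) {η x : ℝ} (hη : 0 < η) (hx : 0 < x) (v : V → ℝ) :
    1 ≤ (R + x + η) * G.augEnergy σ M η x v := by
  -- Cutting `v` off at its largest marked value yields a function that vanishes on `M`, and a
  -- single leaf accounts for the level removed.
  obtain ⟨k₀, hk₀, hmax⟩ := M.exists_max_image v hM
  set φ : V → ℝ := fun u => max (v u - v k₀) 0 with hφ
  have h1 : (∑ u, σ u * φ u) ^ 2 ≤ R * G.dirichlet v := by
    refine (hR.2 φ fun k hk => ?_).trans
      (mul_le_mul_of_nonneg_left (G.dirichlet_mono fun a b => ?_) hR.1)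
    · simpa [hφ] using hmax k hk
    · have := abs_max_sub_max_le_max (v a - v k₀) 0 (v b - v k₀) 0
      simpa using this
  have h2 : v k₀ ^ 2 ≤ x * ∑ k ∈ M, v k ^ 2 / x := by
    rw [← Finset.sum_div, mul_div_cancel₀ _ hx.ne']
    exact Finset.single_le_sum (f := fun k => v k ^ 2) (fun k _ => sq_nonneg _) hk₀
  have h3 : (∑ u, σ u * (1 - v u)) ^ 2 ≤ η * ∑ u, σ u / η * (1 - v u) ^ 2 := by
    refine (sq_sum_mul_le_of_mem_stdSimplex hσ _).trans (le_of_eq ?_)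
    rw [Finset.mul_sum]
    refine Finset.sum_congr rfl fun u _ => ?_
    field_simp
  have h4 : 1 ≤ ∑ u, σ u * φ u + v k₀ + ∑ u, σ u * (1 - v u) := by
    have e : v k₀ = ∑ u, σ u * v k₀ := by rw [← Finset.sum_mul, hσ.2, one_mul]
    rw [e, ← Finset.sum_add_distrib, ← Finset.sum_add_distrib]
    refine hσ.2.symm.le.trans (Finset.sum_le_sum fun u _ => ?_)
    have : v u - v k₀ ≤ φ u := le_max_left _ _
    nlinarith [mul_le_mul_of_nonneg_left this (hσ.1 u)]
  have n1 := G.dirichlet_nonneg v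
  have n2 : 0 ≤ ∑ k ∈ M, v k ^ 2 / x := Finset.sum_nonneg fun k _ => by positivity
  have n3 : 0 ≤ ∑ u, σ u / η * (1 - v u) ^ 2 :=
    Finset.sum_nonneg fun u _ => mul_nonneg (div_nonneg (hσ.1 u) hη.le) (sq_nonneg _)
  have c1 := two_mul_mul_le_of_sq_le hR.1 hx.le n1 n2 h1 h2
  have c2 := two_mul_mul_le_of_sq_le hR.1 hη.le n1 n3 h1 h3
  have c3 := two_mul_mul_le_of_sq_le hx.le hη.le n2 n3 h2 h3
  unfold augEnergy
  nlinarith [h1, h2, h3, c1, c2, c3, h4]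

/-- Along the scales `x = η 2 ^ s`, the flow states of the augmented graphs put, in total, a
constant weight on the edges at the leaves. -/
theorem ResistanceLE.one_sixth_le_sum {R : ℝ} (hR : G.ResistanceLE σ M R)
    (hσ : σ ∈ stdSimplex ℝ V) (hM : M.Nonempty) {η : ℝ} (hη : 0 < η) (hRη : R ≤ η) {J : ℕ}
    (hJ : 6 * (M.card : ℝ) ≤ 2 ^ J) {v : ℕ → V → ℝ}
    (hv : ∀ s, G.IsAugPotential σ M η (η * 2 ^ s) (v s)) :
    1 / 6 ≤ ∑ s ∈ Finset.range J, η * ∑ k ∈ M, v (s + 1) k ^ 2 / (η * 2 ^ (s + 1)) := by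
  set c : ℕ → ℝ := fun s => G.augEnergy σ M η (η * 2 ^ s) (v s) with hc
  -- The minimiser of scale `s + 1` is a competitor at scale `s`, where its leaf energy is twice as
  -- large and the rest is unchanged.
  have hstep : ∀ s, c s - c (s + 1) ≤ ∑ k ∈ M, v (s + 1) k ^ 2 / (η * 2 ^ (s + 1)) := by
    intro s
    have h1 : c s ≤ G.augEnergy σ M η (η * 2 ^ s) (v (s + 1)) := (hv s).minimal _
    have h2 : ∑ k ∈ M, v (s + 1) k ^ 2 / (η * 2 ^ s) =
        2 * ∑ k ∈ M, v (s + 1) k ^ 2 / (η * 2 ^ (s + 1)) := by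
      rw [Finset.mul_sum]
      refine Finset.sum_congr rfl fun k _ => ?_
      rw [pow_succ]
      field_simp
      ring
    simp only [hc, augEnergy] at h1 ⊢
    rw [h2] at h1
    linarith
  have htel : c 0 - c J ≤ ∑ s ∈ Finset.range J, ∑ k ∈ M, v (s + 1) k ^ 2 / (η * 2 ^ (s + 1)) := by
    rw [← Finset.sum_range_sub' c J]
    exact Finset.sum_le_sum fun s _ => hstep s
  -- At scale zero each of the three resistances in series is at most `η`.
  have h0 : 1 ≤ (3 * η) * c 0 := by
    have h := hR.one_le_mul_augEnergy hσ hM hη (x := η * 2 ^ 0) (by positivity) (v 0)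
    have hn : 0 ≤ c 0 := by
      by_contra hneg
      have : 0 < R + η * 2 ^ 0 + η := by have := hR.1; positivity
      have := mul_neg_of_pos_of_neg this (not_le.1 hneg)
      simp only [hc] at this
      linarith
    refine h.trans (mul_le_mul_of_nonneg_right ?_ hn)
    simp
    linarith
  have hJ' : η * c J ≤ 1 / 6 := by
    have h := (hv J).augEnergy_le_card_div
    have h2 : (0 : ℝ) < 2 ^ J := by positivity
    calc η * c J ≤ η * (M.card / (η * 2 ^ J)) := mul_le_mul_of_nonneg_left h hη.le
      _ = M.card / 2 ^ J := by field_simp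
      _ ≤ 1 / 6 := by rw [div_le_iff₀ h2]; linarith
  rw [← Finset.mul_sum]
  have := mul_le_mul_of_nonneg_left htel hη.le
  linarith

end WeightedGraph

/-- Partial sums of the powers of a matrix telescope on vectors of the form `U z - z`. -/
theorem Matrix.sum_pow_mulVec_sub {n R : Type*} [Fintype n] [DecidableEq n] [CommRing R]
    (U : Matrix n n R) (z : n → R) (T : ℕ) :
    ∑ t ∈ Finset.range T, U ^ t *ᵥ (U *ᵥ z - z) = U ^ T *ᵥ z - z := by
  have h : ∀ t, U ^ t *ᵥ (U *ᵥ z - z) = U ^ (t + 1) *ᵥ z - U ^ t *ᵥ z := fun t => by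
    rw [Matrix.mulVec_sub, Matrix.mulVec_mulVec, pow_succ]
  simp only [h]
  rw [Finset.sum_range_sub fun t => U ^ t *ᵥ z, pow_zero, Matrix.one_mulVec]

theorem norm_add_sq_le {a b : ℂ} : ‖a + b‖ ^ 2 ≤ 2 * ‖a‖ ^ 2 + 2 * ‖b‖ ^ 2 := by
  have h := pow_le_pow_left₀ (norm_nonneg _) (norm_add_le a b) 2
  nlinarith [sq_nonneg (‖a‖ - ‖b‖)]

/-! ### Flow state, initial state and averages of the walk -/

namespace SearchProblem

variable {V : Type*} [Fintype V] [DecidableEq V] (P : SearchProblem V)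
  {η x : ℝ} (hη : 0 < η) (hx : 0 < x)

theorem isBipartition_augGraph : (P.augGraph η x hη hx).IsBipartition P.augPart := by
  have hσ : ∀ u, P.σ u / η ≠ 0 → u ∈ P.A := fun u h => by
    by_contra hu
    exact h (by simp [P.supported u hu])
  rintro (u | u | u) (v | v | v) h <;> simp only [augGraph, augWeight] at h <;>
    simp only [augPart, Set.mem_ofPred_eq]
  · exact P.bipartite u v h
  · simp [hσ u h]
  · have := (ite_ne_right_iff.1 h).1
    simp [this]
  · simp [hσ v h]
  · exact absurd rfl h
  · exact absurd rfl h
  · have := (ite_ne_right_iff.1 h).1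
    simp [this]
  · exact absurd rfl h
  · exact absurd rfl h

theorem augWalk_mem_unitaryGroup : P.augWalk η x hη hx ∈ Matrix.unitaryGroup _ ℂ :=
  WeightedGraph.walkOperator_mem_unitaryGroup _ _ (P.isBipartition_augGraph hη hx)

/-- The extension of a potential by the value `s` at the start vertex and `0` at the leaves. -/
def extend {V : Type*} (M : Finset V) (v : V → ℝ) (s : ℝ) : AugVertex V M → ℝ :=
  Sum.elim v (Sum.elim (fun _ => s) 0)

/-- The flow state of a potential in the augmented graph, up to normalisation. -/
def flowState (v : V → ℝ) : P.AugEdge η x hη hx → ℂ := fun e =>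
  ((√(P.augWeight η x e.1.1 e.1.2) * (extend P.M v 1 e.1.2 - extend P.M v 1 e.1.1) : ℝ) : ℂ)

variable {P}

theorem sum_augWeight_mul_sub {v : V → ℝ} (hv : P.G.IsAugPotential P.σ P.M η x v) (u : V) :
    ∑ y, P.augWeight η x (.inl u) y * (extend P.M v 1 (.inl u) - extend P.M v 1 y) = 0 := by
  rw [← hv.harmonic u]
  simp only [Fintype.sum_sum_type, augWeight, extend, Sum.elim_inl, Sum.elim_inr, Pi.zero_apply,
    Finset.univ_unique, Finset.sum_singleton, sub_zero, add_assoc]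
  congr 2
  rw [Finset.sum_coe_sort P.M fun k => (if u = k then 1 / x else 0) * v u]
  simp [ite_mul, div_eq_inv_mul]

/-- Orthogonality to the star state of a vertex is harmonicity of the extended potential there.
Harmonicity may fail only at the start vertex and the leaves, where the diffusion is trivial. -/
theorem reflection_flowState {Q : Set (AugVertex V P.M)} (hQ : Q = P.augPart ∨ Q = P.augPartᶜ)
    {v : V → ℝ} (hv : P.G.IsAugPotential P.σ P.M η x v) :
    (P.augGraph η x hη hx).reflection P.augPart P.augSpecial Q *ᵥ P.flowState hη hx v =
      P.flowState hη hx v := by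
  classical
  refine WeightedGraph.reflection_mulVec_eq_self _ hQ _ fun z hz hS => ?_
  obtain ⟨u, rfl⟩ : ∃ u, z = .inl u := by
    rcases z with u | u
    · exact ⟨u, rfl⟩
    · exact absurd ⟨u, rfl⟩ hS
  have hb := P.isBipartition_augGraph hη hx
  have hlap := sum_augWeight_mul_sub hv u
  have hw : ∀ a b, √(P.augWeight η x a b) * √(P.augWeight η x a b) = P.augWeight η x a b :=
    fun a b => Real.mul_self_sqrt ((P.augGraph η x hη hx).nonneg a b)
  rcases hQ with rfl | rfl
  · have h := WeightedGraph.sum_edge_fst _ hb hz fun a b => extend P.M v 1 b - extend P.M v 1 a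
    have h2 : ∑ y, (P.augGraph η x hη hx).w (.inl u) y *
        (extend P.M v 1 y - extend P.M v 1 (.inl u)) = 0 := by
      rw [← neg_eq_zero, ← hlap, ← Finset.sum_neg_distrib]
      exact Finset.sum_congr rfl fun y _ => by rw [← mul_neg, neg_sub]; rfl
    rw [h2] at h
    simp only [WeightedGraph.endpoint_self, ← mul_assoc]
    simp only [augGraph, hw] at h ⊢
    convert h
  · have h := WeightedGraph.sum_edge_snd _ hb hz fun a b => extend P.M v 1 b - extend P.M v 1 a
    have h2 : ∑ y, (P.augGraph η x hη hx).w (.inl u) y *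
        (extend P.M v 1 (.inl u) - extend P.M v 1 y) = 0 := hlap
    rw [h2] at h
    simp only [WeightedGraph.endpoint_compl, ← mul_assoc]
    simp only [augGraph, hw] at h ⊢
    convert h

theorem extend_eq_zero {V : Type*} [Fintype V] {P : SearchProblem V} (v : V → ℝ) :
    ∀ z ∈ P.augSpecial, extend P.M v 0 z = 0 := by
  rintro _ ⟨u | u, rfl⟩ <;> simp [extend]

/-- The difference of the two extensions is the indicator of the start vertex, which lies outside
`augPart` and so is always the second endpoint. This puts the initial state in the same form as the
flow state. -/
theorem initialState_eq (v : V → ℝ) (e : P.AugEdge η x hη hx) :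
    P.initialState η x hη hx e = ((√(P.augWeight η x e.1.1 e.1.2) *
      (√η * (extend P.M v 1 e.1.2 - extend P.M v 0 e.1.2)) : ℝ) : ℂ) := by
  obtain ⟨⟨a, b⟩, ha, hb, hw⟩ := e
  rcases a with a | a | a <;> rcases b with b | b | b <;>
    simp only [initialState, extend, augWeight, Sum.elim_inl, Sum.elim_inr, sub_self, mul_zero,
      Complex.ofReal_zero, sub_zero, mul_one]
  · rw [← Real.sqrt_mul (div_nonneg (P.isDistribution.1 a) hη.le), div_mul_cancel₀ _ hη.ne']
  · exact absurd ha id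
  · simp

theorem extend_fst (v : V → ℝ) (e : P.AugEdge η x hη hx) :
    extend P.M v 1 e.1.1 = extend P.M v 0 e.1.1 := by
  obtain ⟨⟨a, b⟩, ha, hb, hw⟩ := e
  rcases a with a | a | a
  · rfl
  · exact absurd ha id
  · rfl

-- The initial state lives on edges at the start vertex, whose diffusion is trivial; the other
-- vertices of that part meet none of these edges.
open Classical in
theorem reflection_initialState :
    (P.augGraph η x hη hx).reflection P.augPart P.augSpecial P.augPartᶜ *ᵥ
      P.initialState η x hη hx = P.initialState η x hη hx := by
  have h : P.initialState η x hη hx = fun e => _ := funext fun e => initialState_eq hη hx 0 e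
  rw [h]
  refine WeightedGraph.reflection_mulVec_eq_self _ (Or.inr rfl) _ fun z hz hS => ?_
  refine Finset.sum_eq_zero fun e _ => ?_
  rw [WeightedGraph.endpoint_compl]
  split_ifs with he
  · rcases z with u | u
    · simp [he, extend]
    · exact absurd ⟨u, rfl⟩ hS
  · rfl

/-- As `v` takes values in `[0, 1]`, the edges of the graph contribute at most `2ηW` (each is
counted in both directions) and the start edges at most the mass of `σ`. The leaf edges contribute
at most `η` times the energy, which is at most one. -/
theorem sum_norm_sq_le {v : V → ℝ} (hv : P.G.IsAugPotential P.σ P.M η x v) :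
    ∑ e : P.AugEdge η x hη hx,
      ‖((√(P.augWeight η x e.1.1 e.1.2) * (√η * extend P.M v 0 e.1.1) : ℝ) : ℂ)‖ ^ 2 ≤
        2 * η * P.G.totalWeight + 2 := by
  classical
  have hnn : ∀ a b, 0 ≤ P.augWeight η x a b := (P.augGraph η x hη hx).nonneg
  have h1 : ∀ e : P.AugEdge η x hη hx,
      ‖((√(P.augWeight η x e.1.1 e.1.2) * (√η * extend P.M v 0 e.1.1) : ℝ) : ℂ)‖ ^ 2 =
        P.augWeight η x e.1.1 e.1.2 * (η * extend P.M v 0 e.1.1 ^ 2) := fun e => by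
    rw [Complex.norm_real, Real.norm_eq_abs, sq_abs, mul_pow, mul_pow, Real.sq_sqrt hη.le,
      Real.sq_sqrt (hnn _ _)]
  simp only [h1]
  rw [(P.augGraph η x hη hx).sum_edge P.augPart
    fun a b => P.augWeight η x a b * (η * extend P.M v 0 a ^ 2)]
  have h2 : ∀ a b, (if a ∈ P.augPart ∧ b ∉ P.augPart ∧ (P.augGraph η x hη hx).w a b ≠ 0 then
      P.augWeight η x a b * (η * extend P.M v 0 a ^ 2) else 0) ≤
      P.augWeight η x a b * (η * extend P.M v 0 a ^ 2) := fun a b => by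
    have := hnn a b
    split_ifs
    · exact le_rfl
    · positivity
  refine (Finset.sum_le_sum fun a _ => Finset.sum_le_sum fun b _ => h2 a b).trans ?_
  have hle : ∀ u, v u ^ 2 ≤ 1 := fun u => pow_le_one₀ (hv.nonneg u) (hv.le_one u)
  have h3 : ∑ a, ∑ b, P.augWeight η x a b * (η * extend P.M v 0 a ^ 2) =
      ∑ u, ((∑ y, P.G.w u y) * (η * v u ^ 2) + P.σ u / η * (η * v u ^ 2) +
        ∑ k ∈ P.M, if u = k then η * (v k ^ 2 / x) else 0) := by
    rw [Fintype.sum_sum_type]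
    have : ∀ z : Unit ⊕ {k // k ∈ P.M}, extend P.M v 0 (.inr z) = 0 :=
      fun z => extend_eq_zero v _ ⟨z, rfl⟩
    simp only [this, ne_eq, OfNat.ofNat_ne_zero, not_false_eq_true, zero_pow, mul_zero,
      Finset.sum_const_zero, add_zero]
    refine Finset.sum_congr rfl fun u _ => ?_
    simp only [Fintype.sum_sum_type, augWeight, extend, Sum.elim_inl, Finset.univ_unique,
      Finset.sum_singleton, add_assoc, Finset.sum_mul]
    congr 2
    rw [Finset.sum_coe_sort P.M fun k => (if u = k then 1 / x else 0) * (η * v u ^ 2)]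
    refine Finset.sum_congr rfl fun k _ => ?_
    split_ifs with h
    · rw [h]; ring
    · ring
  rw [h3, Finset.sum_add_distrib, Finset.sum_add_distrib]
  have b1 : ∑ u, (∑ y, P.G.w u y) * (η * v u ^ 2) ≤ 2 * η * P.G.totalWeight := by
    have : 2 * η * P.G.totalWeight = ∑ u, (∑ y, P.G.w u y) * η := by
      rw [← Finset.sum_mul, WeightedGraph.totalWeight]; ring
    rw [this]
    refine Finset.sum_le_sum fun u _ => mul_le_mul_of_nonneg_left ?_
      (Finset.sum_nonneg fun _ _ => P.G.nonneg _ _)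
    exact mul_le_of_le_one_right hη.le (hle u)
  have b2 : ∑ u, P.σ u / η * (η * v u ^ 2) ≤ 1 := by
    rw [← P.isDistribution.2]
    refine Finset.sum_le_sum fun u _ => ?_
    rw [← mul_assoc, div_mul_cancel₀ _ hη.ne']
    exact mul_le_of_le_one_right (P.isDistribution.1 u) (hle u)
  have b3 : ∑ u, ∑ k ∈ P.M, (if u = k then η * (v k ^ 2 / x) else 0) ≤ 1 := by
    rw [Finset.sum_comm]
    simp only [Finset.sum_ite_eq', Finset.mem_univ, if_true, ← Finset.mul_sum]
    have h := hv.augEnergy_le P.isDistribution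
    rw [le_div_iff₀ hη] at h
    have n1 := P.G.dirichlet_nonneg v
    have n3 : 0 ≤ ∑ u, P.σ u / η * (1 - v u) ^ 2 := Finset.sum_nonneg fun u _ =>
      mul_nonneg (div_nonneg (P.isDistribution.1 u) hη.le) (sq_nonneg _)
    unfold WeightedGraph.augEnergy at h
    nlinarith
  linarith

/-- With `a` and `b` the potential read at the first and second endpoints, the initial state is `√η`
times the flow state plus `a - b`. Here `RA` negates `a`, while `RB` negates `b` and fixes `a - b`,
a combination of two fixed vectors. Hence `z = 2b - a` is sent to `-a` by `RB` and to `a` by the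
walk, so `U z - z = 2(a - b)` and `‖z‖ = ‖a‖`. -/
theorem exists_initialState_eq {v : V → ℝ} (hv : P.G.IsAugPotential P.σ P.M η x v) :
    ∃ z : P.AugEdge η x hη hx → ℂ,
      P.initialState η x hη hx = (√η : ℂ) • P.flowState hη hx v +
        (1 / 2 : ℂ) • (P.augWalk η x hη hx *ᵥ z - z) ∧
      ∑ e, ‖z e‖ ^ 2 ≤ 2 * η * P.G.totalWeight + 2 := by
  set G' := P.augGraph η x hη hx with hG'
  have hb := P.isBipartition_augGraph hη hx
  set a : P.AugEdge η x hη hx → ℂ := fun e =>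
    ((√(P.augWeight η x e.1.1 e.1.2) * (√η * extend P.M v 0 e.1.1) : ℝ) : ℂ) with ha
  set b : P.AugEdge η x hη hx → ℂ := fun e =>
    ((√(P.augWeight η x e.1.1 e.1.2) * (√η * extend P.M v 0 e.1.2) : ℝ) : ℂ) with hbdef
  set RA := G'.reflection P.augPart P.augSpecial P.augPart with hRA
  set RB := G'.reflection P.augPart P.augSpecial P.augPartᶜ with hRB
  have hzero : ∀ z ∈ P.augSpecial, √η * extend P.M v 0 z = 0 := fun z hz => by
    rw [extend_eq_zero v z hz, mul_zero]
  have hAa : RA *ᵥ a = -a := by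
    have h := G'.reflection_mulVec_eq_neg (Or.inl rfl) hb (fun z => √η * extend P.M v 0 z) hzero
    simp only [WeightedGraph.endpoint_self] at h
    exact h
  have hBb : RB *ᵥ b = -b := by
    have h := G'.reflection_mulVec_eq_neg (Or.inr rfl) hb (fun z => √η * extend P.M v 0 z) hzero
    simp only [WeightedGraph.endpoint_compl] at h
    exact h
  have hdec : P.initialState η x hη hx = (√η : ℂ) • P.flowState hη hx v + (a - b) := by
    ext e
    rw [initialState_eq hη hx v]
    simp only [Pi.add_apply, Pi.smul_apply, Pi.sub_apply, flowState, ha, hbdef, smul_eq_mul,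
      extend_fst hη hx v e]
    push_cast
    ring
  have hBg := reflection_flowState hη hx (Or.inr rfl) hv
  have hBs := reflection_initialState (P := P) hη hx
  have hBab : RB *ᵥ (a - b) = a - b := by
    have : a - b = P.initialState η x hη hx - (√η : ℂ) • P.flowState hη hx v := by
      rw [hdec]; abel
    rw [this, Matrix.mulVec_sub, Matrix.mulVec_smul]
    rw [hBs, hBg]
  have hUz : P.augWalk η x hη hx *ᵥ (b - (a - b)) = a := by
    change (RA * RB) *ᵥ (b - (a - b)) = a
    rw [← Matrix.mulVec_mulVec, Matrix.mulVec_sub, hBab, hBb,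
      show -b - (a - b) = -a by abel, Matrix.mulVec_neg, hAa, neg_neg]
  refine ⟨b - (a - b), ?_, ?_⟩
  · rw [hUz, hdec]
    congr 1
    ext e
    simp only [Pi.sub_apply, Pi.smul_apply, smul_eq_mul]
    ring
  · rw [← Matrix.sum_norm_sq_mulVec (P.augWalk_mem_unitaryGroup hη hx), hUz]
    exact sum_norm_sq_le hη hx hv

/-- Up to a bounded error, averaging over the walk projects the initial state to the flow state. -/
theorem exists_sum_pow_augWalk_eq {v : V → ℝ} (hv : P.G.IsAugPotential P.σ P.M η x v) (T : ℕ) :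
    ∃ r : P.AugEdge η x hη hx → ℂ,
      ∑ t ∈ Finset.range T, P.augWalk η x hη hx ^ t *ᵥ P.initialState η x hη hx =
        ((T : ℂ) * (√η : ℂ)) • P.flowState hη hx v + r ∧
      ∑ e, ‖r e‖ ^ 2 ≤ 2 * η * P.G.totalWeight + 2 := by
  obtain ⟨z, hz, hn⟩ := exists_initialState_eq hη hx hv
  set U := P.augWalk η x hη hx with hU
  have hUg : U *ᵥ P.flowState hη hx v = P.flowState hη hx v := by
    change (_ * _) *ᵥ _ = _
    rw [← Matrix.mulVec_mulVec, reflection_flowState hη hx (Or.inr rfl) hv,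
      reflection_flowState hη hx (Or.inl rfl) hv]
  have hUtg : ∀ t : ℕ, U ^ t *ᵥ P.flowState hη hx v = P.flowState hη hx v := by
    intro t
    induction t with
    | zero => rw [pow_zero, Matrix.one_mulVec]
    | succ t ih => rw [pow_succ, ← Matrix.mulVec_mulVec, hUg, ih]
  have hunit : ∀ t : ℕ, U ^ t ∈ Matrix.unitaryGroup _ ℂ :=
    fun t => pow_mem (P.augWalk_mem_unitaryGroup hη hx) t
  refine ⟨(1 / 2 : ℂ) • (U ^ T *ᵥ z - z), ?_, ?_⟩
  · rw [hz]
    simp only [Matrix.mulVec_add, Matrix.mulVec_smul, hUtg, Finset.sum_add_distrib,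
      Finset.sum_const, Finset.card_range, ← Finset.smul_sum, Matrix.sum_pow_mulVec_sub]
    rw [← Nat.cast_smul_eq_nsmul ℂ, smul_smul]
  · refine le_trans ?_ hn
    have h1 : ∀ e, ‖((1 / 2 : ℂ) • (U ^ T *ᵥ z - z)) e‖ ^ 2 ≤
        (1 / 2) * ‖(U ^ T *ᵥ z) e‖ ^ 2 + (1 / 2) * ‖z e‖ ^ 2 := by
      intro e
      have h := norm_add_sq_le (a := (U ^ T *ᵥ z) e) (b := -z e)
      rw [norm_neg, ← sub_eq_add_neg] at h
      simp only [Pi.smul_apply, Pi.sub_apply, smul_eq_mul, norm_mul, mul_pow]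
      norm_num
      linarith
    refine (Finset.sum_le_sum fun e _ => h1 e).trans (le_of_eq ?_)
    rw [Finset.sum_add_distrib, ← Finset.mul_sum, ← Finset.mul_sum,
      Matrix.sum_norm_sq_mulVec (hunit T)]
    ring

theorem exists_leafEdge {k : V} (hk : k ∈ P.M) (v : V → ℝ) :
    ∃ e : P.AugEdge η x hη hx, P.found e = some k ∧
      ‖P.flowState hη hx v e‖ ^ 2 = v k ^ 2 / x := by
  have hsq : ∀ y : ℝ, ‖((√(1 / x) * y : ℝ) : ℂ)‖ ^ 2 = y ^ 2 / x := fun y => by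
    rw [Complex.norm_real, Real.norm_eq_abs, sq_abs, mul_pow, Real.sq_sqrt (by positivity)]
    ring
  by_cases hA : k ∈ P.A
  · refine ⟨⟨(.inl k, .inr (.inr ⟨k, hk⟩)), hA, fun h => h hA, ?_⟩, rfl, ?_⟩
    · simp [augGraph, augWeight, hx.ne']
    · simp only [flowState, augWeight, extend, if_true, Sum.elim_inl, Sum.elim_inr, Pi.zero_apply]
      rw [hsq]
      ring
  · refine ⟨⟨(.inr (.inr ⟨k, hk⟩), .inl k), hA, hA, ?_⟩, rfl, ?_⟩
    · simp [augGraph, augWeight, hx.ne']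
    · simp only [flowState, augWeight, extend, if_true, Sum.elim_inl, Sum.elim_inr, Pi.zero_apply]
      rw [hsq]
      ring

theorem mem_of_found_eq_some {e : P.AugEdge η x hη hx} {k : V} (h : P.found e = some k) :
    k ∈ P.M := by
  obtain ⟨⟨a, b⟩, he⟩ := e
  rcases a with a | a | a <;> rcases b with b | b | b <;> simp only [found] at h <;>
    first
      | (cases h; exact a.2)
      | (cases h; exact b.2)
      | cases h

theorem sum_norm_sq_initialState : ∑ e, ‖P.initialState η x hη hx e‖ ^ 2 = 1 := by
  classical
  have h := (P.augGraph η x hη hx).sum_edge P.augPart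
    fun a b => match a, b with
      | .inl u, .inr (.inl _) => P.σ u
      | _, _ => 0
  have h2 : ∀ e : P.AugEdge η x hη hx, ‖P.initialState η x hη hx e‖ ^ 2 =
      match e.1.1, e.1.2 with
      | .inl u, .inr (.inl _) => P.σ u
      | _, _ => 0 := by
    rintro ⟨⟨a, b⟩, he⟩
    rcases a with a | a | a <;> rcases b with b | b | b <;>
      simp [initialState, Real.sq_sqrt (P.isDistribution.1 _)]
  rw [Finset.sum_congr rfl fun e _ => h2 e, h, ← P.isDistribution.2]
  simp only [Fintype.sum_sum_type, ite_self, Finset.sum_const_zero, add_zero, zero_add,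
    Finset.univ_unique, Finset.sum_singleton]
  refine Finset.sum_congr rfl fun u _ => ?_
  by_cases hu : P.σ u = 0
  · simp [hu]
  · have : u ∈ P.A := by
      by_contra h
      exact hu (P.supported u h)
    rw [if_pos]
    refine ⟨this, id, ?_⟩
    simp only [augGraph, augWeight]
    exact div_ne_zero hu hη.ne'

end SearchProblem

/-- The vector by which a Householder reflection moves a basis state to the uniform
superposition. -/
def householderVec (n : ℕ) (i : Fin (n + 1)) : ℝ := (if i = 0 then 1 else 0) - 1 / √(n + 1)

/-- For `n = 0` the vector is zero, and division by zero makes the projection zero and the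
reflection the identity, as desired. -/
def householderProj (n : ℕ) : Matrix (Fin (n + 1)) (Fin (n + 1)) ℂ := fun i j =>
  ((householderVec n i * householderVec n j / (2 * (1 - 1 / √(n + 1))) : ℝ) : ℂ)

theorem sum_householderVec_sq (n : ℕ) :
    ∑ i, householderVec n i * householderVec n i = 2 * (1 - 1 / √(n + 1)) := by
  have hs : (0 : ℝ) < √(n + 1) := Real.sqrt_pos.2 (by positivity)
  have hc : (1 / √((n : ℝ) + 1)) * (1 / √((n : ℝ) + 1)) * (n + 1) = 1 := by
    rw [div_mul_div_comm, Real.mul_self_sqrt (by positivity)]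
    field_simp
  set c := 1 / √((n : ℝ) + 1) with hcdef
  rw [Fin.sum_univ_succ]
  simp only [householderVec, if_true, Fin.succ_ne_zero, if_false, ← hcdef, Finset.sum_const,
    Finset.card_univ, Fintype.card_fin, nsmul_eq_mul]
  linear_combination hc

theorem householderProj_mul_self (n : ℕ) :
    householderProj n * householderProj n = householderProj n := by
  ext i j
  rw [Matrix.mul_apply]
  set d := 2 * (1 - 1 / √((n : ℝ) + 1)) with hd
  have h : ∀ k, householderProj n i k * householderProj n k j =
      ((householderVec n i * householderVec n j / d ^ 2 *
        (householderVec n k * householderVec n k) : ℝ) : ℂ) := fun k => by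
    simp only [householderProj, ← hd, ← Complex.ofReal_mul]
    congr 1
    rw [div_mul_div_comm, div_mul_eq_mul_div, pow_two]
    congr 1
    ring
  simp only [h]
  rw [← Complex.ofReal_sum, ← Finset.mul_sum, sum_householderVec_sq, ← hd]
  simp only [householderProj, ← hd]
  congr 1
  by_cases h0 : d = 0
  · simp [h0]
  · field_simp

/-- A unitary that prepares the uniform superposition from the first basis state. -/
def uniformUnitary (n : ℕ) : Matrix.unitaryGroup (Fin (n + 1)) ℂ :=
  ⟨1 - (2 : ℂ) • householderProj n, Matrix.one_sub_two_smul_mem_unitaryGroup (by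
    ext i j
    simp only [Matrix.conjTranspose_apply, householderProj, RCLike.star_def, Complex.conj_ofReal,
      mul_comm]) (householderProj_mul_self n)⟩

theorem uniformUnitary_apply_zero (n : ℕ) (i : Fin (n + 1)) :
    (uniformUnitary n).1 i 0 = ((1 / √(n + 1) : ℝ) : ℂ) := by
  have h : (uniformUnitary n).1 i 0 = (((if i = 0 then 1 else 0) -
      2 * (householderVec n i * householderVec n 0 / (2 * (1 - 1 / √(n + 1)))) : ℝ) : ℂ) := by
    simp only [uniformUnitary, householderProj, Matrix.sub_apply, Matrix.smul_apply, smul_eq_mul,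
      Matrix.one_apply]
    split_ifs <;> simp
  rw [h]
  congr 1
  rcases Nat.eq_zero_or_pos n with rfl | hn
  · have : i = 0 := Fin.fin_one_eq_zero i
    simp [this]
  · have hs : 1 < √((n : ℝ) + 1) := by
      rw [Real.lt_sqrt zero_le_one]
      have : (0 : ℝ) < n := by exact_mod_cast hn
      linarith
    have hc : 1 - 1 / √((n : ℝ) + 1) ≠ 0 := by
      have : 1 / √((n : ℝ) + 1) < 1 := by rw [div_lt_one (by linarith)]; exact hs
      linarith
    simp only [householderVec, if_true]
    rw [mul_div_mul_comm, div_self hc]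
    ring

/-! ### The averaging circuit and its success probability -/

namespace QCircuit

variable {V : Type*} [Fintype V] [DecidableEq V]

theorem sum_norm_sq_gate_apply {n : ℕ} {E : Type*} [Fintype E] [DecidableEq E]
    {U : Matrix E E ℂ} (hU : U ∈ Matrix.unitaryGroup E ℂ) (ψ : Fin n × E → ℂ) (g : Gate n) :
    ∑ z, ‖g.apply U ψ z‖ ^ 2 = ∑ z, ‖ψ z‖ ^ 2 := by
  cases g with
  | ancilla B =>
    simp only [Gate.apply, Fintype.sum_prod_type_right]
    exact Finset.sum_congr rfl fun e _ =>
      Matrix.sum_norm_sq_mulVec B.2 fun j => ψ (j, e)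
  | walk ctrl =>
    simp only [Gate.apply, Fintype.sum_prod_type]
    refine Finset.sum_congr rfl fun j _ => ?_
    by_cases h : ctrl j
    · simp only [h, if_true]
      exact Matrix.sum_norm_sq_mulVec hU fun e => ψ (j, e)
    · simp [h]

theorem sum_outcomeProb (c : QCircuit) (P : SearchProblem V) :
    ∑ j, ∑ e, c.outcomeProb P j e = 1 := by
  have h : ∀ (l : List (Gate (c.n + 1))) (ψ), ∑ z, ‖l.foldl (fun ψ g =>
      g.apply (P.augWalk c.η c.x c.η_pos c.x_pos) ψ) ψ z‖ ^ 2 = ∑ z, ‖ψ z‖ ^ 2 := by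
    intro l
    induction l with
    | nil => intro ψ; rfl
    | cons g l ih =>
      intro ψ
      rw [List.foldl_cons, ih,
        sum_norm_sq_gate_apply (P.augWalk_mem_unitaryGroup c.η_pos c.x_pos)]
  unfold outcomeProb finalState
  rw [← Fintype.sum_prod_type' (f := fun j e => ‖_‖ ^ 2), h, Fintype.sum_prod_type,
    Finset.sum_eq_single 0]
  · simpa using SearchProblem.sum_norm_sq_initialState (P := P) c.η_pos c.x_pos
  · intro j _ hj
    simp [hj]
  · simp

/-- The probability that a circuit finds a marked vertex. -/
def foundProb (c : QCircuit) (P : SearchProblem V) : ℝ :=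
  ∑ j, ∑ e, if (P.found e).isSome then c.outcomeProb P j e else 0

theorem outcomeProb_nonneg (c : QCircuit) (P : SearchProblem V) (j : Fin (c.n + 1))
    (e : P.AugEdge c.η c.x c.η_pos c.x_pos) : 0 ≤ c.outcomeProb P j e :=
  sq_nonneg _

theorem foundProb_nonneg (c : QCircuit) (P : SearchProblem V) : 0 ≤ c.foundProb P :=
  Finset.sum_nonneg fun j _ => Finset.sum_nonneg fun e _ => by
    split_ifs
    · exact c.outcomeProb_nonneg P j e
    · exact le_rfl

theorem foundProb_le_one (c : QCircuit) (P : SearchProblem V) : c.foundProb P ≤ 1 := by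
  rw [← c.sum_outcomeProb P]
  refine Finset.sum_le_sum fun j _ => Finset.sum_le_sum fun e _ => ?_
  split_ifs
  · exact le_rfl
  · exact c.outcomeProb_nonneg P j e

/-- A circuit whose amplitudes at the ancilla state `0` are those of the average of the first
`n + 1` powers of the walk operator. -/
def averaging (η x : ℝ) (hη : 0 < η) (hx : 0 < x) (n : ℕ) : QCircuit where
  η := η
  x := x
  η_pos := hη
  x_pos := hx
  n := n
  -- The controls `s < j` with `s` in `range n` let exactly `j` walk steps act on branch `j`.
  -- Undoing the preparation then collects the average at ancilla `0`, so `n` steps average `n + 1`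
  -- powers.
  gates := .ancilla (uniformUnitary n) ::
    ((List.range n).map fun s => .walk fun j => decide (s < j.1)) ++ [.ancilla (uniformUnitary n)⁻¹]

theorem cost_averaging {η x : ℝ} (hη : 0 < η) (hx : 0 < x) (n : ℕ) :
    (averaging η x hη hx n).cost = n + 1 := by
  simp [cost, walkSteps, averaging, Gate.isWalk, List.countP_append,
    List.countP_map, Function.comp_def]

variable {P : SearchProblem V} {η x : ℝ} (hη : 0 < η) (hx : 0 < x)

/-- The average of the first `n + 1` powers of the walk operator, applied to the initial state. -/
def averagedState (P : SearchProblem V) (n : ℕ) : P.AugEdge η x hη hx → ℂ := fun e =>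
  (1 / (n + 1) : ℂ) * (∑ t ∈ Finset.range (n + 1),
    P.augWalk η x hη hx ^ t *ᵥ P.initialState η x hη hx) e

theorem finalState_averaging (n : ℕ) (e : P.AugEdge η x hη hx) :
    (averaging η x hη hx n).finalState P ((0 : Fin (n + 1)), e) =
      averagedState hη hx P n e := by
  unfold averagedState
  set U := P.augWalk η x hη hx with hU
  set c : ℂ := ((1 / √(n + 1) : ℝ) : ℂ) with hc
  set ψ₀ : Fin (n + 1) × P.AugEdge η x hη hx → ℂ :=
    fun z => if z.1 = 0 then P.initialState η x hη hx z.2 else 0 with hψ₀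
  have hfirst : (Gate.ancilla (uniformUnitary n)).apply U ψ₀ =
      fun z => c * P.initialState η x hη hx z.2 := by
    ext z
    simp only [Gate.apply, hψ₀]
    rw [Finset.sum_eq_single 0]
    · simp [uniformUnitary_apply_zero, hc]
    · intro j _ hj
      simp [hj]
    · simp
  have hwalk : ∀ k : ℕ, ((List.range k).map fun s =>
      (Gate.walk (fun j => decide (s < j.1)) : Gate (n + 1))).foldl (fun ψ g => g.apply U ψ)
        (fun z => c * P.initialState η x hη hx z.2) =
      fun z => c * (U ^ (min z.1.1 k) *ᵥ P.initialState η x hη hx) z.2 := by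
    intro k
    induction k with
    | zero => simp
    | succ k ih =>
      rw [List.range_succ, List.map_append, List.foldl_append, ih]
      ext z
      simp only [List.map_cons, List.map_nil, List.foldl_cons, List.foldl_nil, Gate.apply,
        decide_eq_true_eq]
      split_ifs with h
      · rw [min_eq_right h.le, min_eq_right (Nat.succ_le_of_lt h), pow_succ',
          ← Matrix.mulVec_mulVec, Matrix.mulVec, dotProduct, Finset.mul_sum]
        exact Finset.sum_congr rfl fun e' _ => by ring
      · have h' : z.1.1 ≤ k := not_lt.1 h
        rw [min_eq_left h', min_eq_left (h'.trans (Nat.le_succ k))]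
  have hlast : ∀ j, (uniformUnitary n)⁻¹.1 0 j = c := by
    intro j
    change star (uniformUnitary n).1 0 j = c
    rw [Matrix.star_apply, uniformUnitary_apply_zero, RCLike.star_def, Complex.conj_ofReal]
  have hcc : c * c = 1 / (n + 1) := by
    rw [hc, ← Complex.ofReal_mul, div_mul_div_comm, Real.mul_self_sqrt (by positivity)]
    push_cast
    ring
  change ((Gate.ancilla (uniformUnitary n) ::
    ((List.range n).map fun s => (Gate.walk fun j => decide (s < j.1) : Gate (n + 1))) ++
      [Gate.ancilla (uniformUnitary n)⁻¹]).foldl (fun ψ g => g.apply U ψ) ψ₀) (0, e) = _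
  rw [List.foldl_append, List.foldl_cons (b := ψ₀), hfirst, hwalk]
  simp only [List.foldl_cons, List.foldl_nil, Gate.apply, hlast]
  rw [Finset.sum_apply, Finset.sum_range, Finset.mul_sum]
  refine Finset.sum_congr rfl fun j _ => ?_
  rw [min_eq_left (Nat.le_of_lt_succ j.2), ← mul_assoc, hcc]

/-- Only the outcomes with ancilla `0` and a leaf edge are counted. There the state is `√η` times
the flow state plus `r / (n + 1)`. -/
theorem le_foundProb_averaging {v : V → ℝ} (hv : P.G.IsAugPotential P.σ P.M η x v) (n : ℕ) :
    1 / 2 * (η * ∑ k ∈ P.M, v k ^ 2 / x) - (2 * η * P.G.totalWeight + 2) / (n + 1) ^ 2 ≤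
      (averaging η x hη hx n).foundProb P := by
  classical
  obtain ⟨r, hr, hn⟩ := SearchProblem.exists_sum_pow_augWalk_eq hη hx hv (n + 1)
  have hn0 : (0 : ℝ) < n + 1 := by positivity
  have hstate : ∀ e, averagedState hη hx P n e =
      (√η : ℂ) * P.flowState hη hx v e + (1 / (n + 1) : ℂ) * r e := by
    intro e
    unfold averagedState
    rw [hr]
    have : (n + 1 : ℂ) ≠ 0 := by exact_mod_cast hn0.ne'
    simp only [Pi.add_apply, Pi.smul_apply, smul_eq_mul]
    push_cast
    field_simp
  have hpt : ∀ e, 1 / 2 * (η * ‖P.flowState hη hx v e‖ ^ 2) - ‖r e‖ ^ 2 / (n + 1) ^ 2 ≤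
      ‖averagedState hη hx P n e‖ ^ 2 := by
    intro e
    -- Adding and subtracting the error gives `‖A + B‖² ≥ ‖A‖² / 2 - ‖B‖²`.
    have h := norm_add_sq_le (a := (√η : ℂ) * P.flowState hη hx v e + (1 / (n + 1) : ℂ) * r e)
      (b := -((1 / (n + 1) : ℂ) * r e))
    rw [norm_neg, add_neg_cancel_right, ← hstate] at h
    have e1 : ‖(√η : ℂ) * P.flowState hη hx v e‖ ^ 2 = η * ‖P.flowState hη hx v e‖ ^ 2 := by
      rw [norm_mul, mul_pow, Complex.norm_real, Real.norm_eq_abs, sq_abs, Real.sq_sqrt hη.le]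
    have e2 : ‖(1 / (n + 1) : ℂ) * r e‖ ^ 2 = ‖r e‖ ^ 2 / (n + 1) ^ 2 := by
      have : (1 / (n + 1) : ℂ) = ((1 / (n + 1) : ℝ) : ℂ) := by push_cast; rfl
      rw [this, norm_mul, mul_pow, Complex.norm_real, Real.norm_eq_abs, sq_abs,
        div_pow, one_pow, div_mul_eq_mul_div, one_mul]
    rw [e1, e2] at h
    linarith
  -- The choice function `leaf` needs a default edge at unmarked vertices.
  have : Nonempty (P.AugEdge η x hη hx) := by
    by_contra hne
    rw [not_nonempty_iff] at hne
    simpa using SearchProblem.sum_norm_sq_initialState (P := P) hη hx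
  choose! leaf hleaf using fun k (hk : k ∈ P.M) => SearchProblem.exists_leafEdge hη hx hk v
  have hinj : Set.InjOn leaf P.M := by
    intro k hk k' hk' h
    have := (hleaf k hk).1
    rw [h, (hleaf k' hk').1] at this
    exact (Option.some.inj this).symm
  have hsub : ∑ k ∈ P.M, ‖averagedState hη hx P n (leaf k)‖ ^ 2 ≤
      (averaging η x hη hx n).foundProb P := by
    have hout : ∀ e : P.AugEdge η x hη hx,
        (averaging η x hη hx n).outcomeProb P (0 : Fin (n + 1)) e =
          ‖averagedState hη hx P n e‖ ^ 2 :=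
      fun e => congrArg (fun a => ‖a‖ ^ 2) (finalState_averaging hη hx n e)
    unfold foundProb
    refine le_trans ?_ (Finset.single_le_sum (f := fun j => ∑ e, if (P.found e).isSome then
      (averaging η x hη hx n).outcomeProb P j e else 0) (fun j _ => Finset.sum_nonneg fun e _ => by
        split_ifs
        · exact outcomeProb_nonneg _ _ _ _
        · exact le_rfl) (Finset.mem_univ (0 : Fin (n + 1))))
    change _ ≤ ∑ e : P.AugEdge η x hη hx, if (P.found e).isSome then
      (averaging η x hη hx n).outcomeProb P (0 : Fin (n + 1)) e else 0
    simp only [hout]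
    rw [← Finset.sum_filter, ← Finset.sum_image (f := fun e =>
      ‖averagedState hη hx P n e‖ ^ 2) hinj]
    refine Finset.sum_le_sum_of_subset_of_nonneg ?_ fun e _ _ => sq_nonneg _
    intro e he
    obtain ⟨k, hk, rfl⟩ := Finset.mem_image.1 he
    simp [(hleaf k hk).1]
  refine le_trans ?_ hsub
  refine le_trans ?_ (Finset.sum_le_sum fun k _ => hpt (leaf k))
  rw [Finset.sum_sub_distrib, ← Finset.mul_sum, ← Finset.mul_sum,
    Finset.sum_congr rfl fun k hk => (hleaf k hk).2]
  have : ∑ k ∈ P.M, ‖r (leaf k)‖ ^ 2 ≤ 2 * η * P.G.totalWeight + 2 := by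
    refine le_trans ?_ hn
    rw [← Finset.sum_image (f := fun e => ‖r e‖ ^ 2) hinj]
    exact Finset.sum_le_sum_of_subset_of_nonneg (Finset.subset_univ _) fun e _ _ => sq_nonneg _
  have h3 : ∑ k ∈ P.M, ‖r (leaf k)‖ ^ 2 / ((n : ℝ) + 1) ^ 2 ≤
      (2 * η * P.G.totalWeight + 2) / (n + 1) ^ 2 := by
    rw [← Finset.sum_div]
    exact div_le_div_of_nonneg_right this (by positivity)
  exact sub_le_sub_left h3 _

end QCircuit

theorem List.sum_map_flatMap_range {α R : Type*} [AddCommMonoid R] (g : ℕ → List α) (f : α → R)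
    (n : ℕ) : (((List.range n).flatMap g).map f).sum =
      ∑ i ∈ Finset.range n, ((g i).map f).sum := by
  induction n with
  | zero => simp
  | succ n ih =>
    rw [List.range_succ, List.flatMap_append, List.map_append, List.sum_append, ih,
      Finset.sum_range_succ]
    simp

theorem List.sum_map_range {R : Type*} [AddCommMonoid R] (f : ℕ → R) (n : ℕ) :
    ((List.range n).map f).sum = ∑ i ∈ Finset.range n, f i := by
  induction n with
  | zero => simp
  | succ n ih => simp [List.range_succ, Finset.sum_range_succ, ih]

/-- The extra summand is the tail of the geometric series and makes the induction close. -/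
theorem sum_two_pow_sub_le (t : ℕ) : ∀ k ≤ t + 1,
    ∑ j ∈ Finset.range k, 2 ^ (t - j) + 2 ^ (t + 1 - k) ≤ 2 ^ (t + 1) := by
  intro k
  induction k with
  | zero => simp
  | succ k ih =>
    intro hk
    have h := ih (by omega)
    have e1 : t + 1 - k = (t - k) + 1 := by omega
    have e2 : t + 1 - (k + 1) = t - k := by omega
    rw [Finset.sum_range_succ, e2]
    rw [e1, pow_succ] at h
    omega

/-! ### Success probability of a sequence of circuits -/

namespace QAlgorithm

variable {V : Type*} [Fintype V] [DecidableEq V]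

theorem outputProbAux_nonneg (alg : QAlgorithm) (P : SearchProblem V) (v : V) :
    ∀ r T h, 0 ≤ alg.outputProbAux P v r T h := by
  intro r
  induction r with
  | zero => intro T h; exact le_rfl
  | succ r ih =>
    intro T h
    rw [outputProbAux]
    split_ifs
    · refine Finset.sum_nonneg fun j _ => Finset.sum_nonneg fun e _ =>
        mul_nonneg ((alg h).outcomeProb_nonneg P j e) ?_
      split
      · split_ifs <;> norm_num
      · exact ih _ _
    · exact le_rfl

/-- The algorithm that runs the circuits of a sequence, ignoring the outcomes. -/
def ofSequence (f : ℕ → QCircuit) : QAlgorithm := fun h => f h.length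

/-- The first `N` circuits fit into the budget, so the run reaches all of them unless it succeeds
earlier, and their failures multiply. -/
theorem one_sub_sum_outputProbAux_le (f : ℕ → QCircuit) (P : SearchProblem V) :
    ∀ (N r T : ℕ) (h : List ℕ), N ≤ r →
      ∑ i ∈ Finset.range N, (f (h.length + i)).cost ≤ T →
      1 - ∑ v ∈ P.M, (ofSequence f).outputProbAux P v r T h ≤
        ∏ i ∈ Finset.range N, (1 - (f (h.length + i)).foundProb P) := by
  intro N
  induction N with
  | zero =>
    intro r T h _ _
    have := Finset.sum_nonneg fun v (_ : v ∈ P.M) => (ofSequence f).outputProbAux_nonneg P v r T h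
    simp only [Finset.range_zero, Finset.prod_empty]
    linarith
  | succ N ih =>
    intro r T h hr hT
    obtain ⟨r, rfl⟩ : ∃ r', r = r' + 1 := ⟨r - 1, by omega⟩
    rw [Finset.sum_range_succ'] at hT
    rw [Finset.prod_range_succ']
    simp only [add_zero] at hT ⊢
    set π := ∏ i ∈ Finset.range N, (1 - (f (h.length + (i + 1))).foundProb P) with hπ
    set c := f h.length with hc
    have hcost : c.cost ≤ T := by omega
    have hrest : ∀ j : ℕ, 1 - ∑ v ∈ P.M,
        (ofSequence f).outputProbAux P v r (T - c.cost) (h ++ [j]) ≤ π := by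
      intro j
      have e : ∀ i, (h ++ [j]).length + i = h.length + (i + 1) := fun i => by simp; omega
      have := ih r (T - c.cost) (h ++ [j]) (by omega)
        (by simp only [e]; omega)
      simpa only [e] using this
    have hstep : ∑ v ∈ P.M, (ofSequence f).outputProbAux P v (r + 1) T h =
        ∑ j, ∑ e, c.outcomeProb P j e * (∑ v ∈ P.M, match P.found e with
          | some k => if k = v then 1 else 0
          | none => (ofSequence f).outputProbAux P v r (T - c.cost) (h ++ [j.1])) := by
      have : ∀ v, (ofSequence f).outputProbAux P v (r + 1) T h =
          ∑ j, ∑ e, c.outcomeProb P j e * (match P.found e with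
          | some k => if k = v then 1 else 0
          | none => (ofSequence f).outputProbAux P v r (T - c.cost) (h ++ [j.1])) := by
        intro v
        rw [outputProbAux]
        exact if_pos hcost
      simp only [this, Finset.mul_sum]
      rw [Finset.sum_comm]
      exact Finset.sum_congr rfl fun j _ => Finset.sum_comm
    rw [hstep]
    -- A hit is worth one and a miss at least `1 - π`. Written as `1 - π` plus `π` for a hit, the
    -- bound sums to `(1 - π) + foundProb * π`.
    have hpt : ∀ j e, c.outcomeProb P j e * (1 - π) +
        (if (P.found e).isSome then c.outcomeProb P j e else 0) * π ≤
        c.outcomeProb P j e * (∑ v ∈ P.M, match P.found e with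
          | some k => if k = v then (1 : ℝ) else 0
          | none => (ofSequence f).outputProbAux P v r (T - c.cost) (h ++ [j.1])) := by
      intro j e
      rcases hf : P.found e with _ | k
      · simp only [Option.isSome_none, Bool.false_eq_true, if_false, zero_mul, add_zero]
        exact mul_le_mul_of_nonneg_left (by linarith [hrest j.1]) (c.outcomeProb_nonneg P j e)
      · have hk := SearchProblem.mem_of_found_eq_some c.η_pos c.x_pos hf
        simp only [Option.isSome_some, if_true, Finset.sum_ite_eq, hk, mul_one]
        linarith
    have hsum := Finset.sum_le_sum fun j (_ : j ∈ Finset.univ) =>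
      Finset.sum_le_sum fun e (_ : e ∈ Finset.univ) => hpt j e
    simp only [Finset.sum_add_distrib, ← Finset.sum_mul] at hsum
    rw [c.sum_outcomeProb P] at hsum
    change _ + c.foundProb P * π ≤ _ at hsum
    linarith

/-- Running the circuits of a list succeeds with probability at least `2 / 3` if their individual
success probabilities sum to at least `2`. -/
theorem two_thirds_le_successProb {f : ℕ → QCircuit} {L : List QCircuit}
    (hL : (List.range L.length).map f = L) (P : SearchProblem V) {T : ℕ}
    (hT : (L.map QCircuit.cost).sum ≤ T) (hp : 2 ≤ (L.map fun c => c.foundProb P).sum) :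
    2 / 3 ≤ (ofSequence f).successProb P T := by
  have hcost : ∑ i ∈ Finset.range L.length, (f i).cost ≤ T := by
    rw [← hL, List.map_map, List.sum_map_range] at hT
    simpa using hT
  have hfound : 2 ≤ ∑ i ∈ Finset.range L.length, (f i).foundProb P := by
    rw [← hL, List.map_map, List.sum_map_range] at hp
    simpa using hp
  have hlen : L.length ≤ T := by
    refine le_trans ?_ hcost
    simpa using Finset.card_nsmul_le_sum (Finset.range L.length) (fun i => (f i).cost) 1
      fun i _ => Nat.le_add_left 1 _
  have h := one_sub_sum_outputProbAux_le f P L.length T T [] hlen (by simpa using hcost)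
  simp only [List.length_nil, zero_add] at h
  have h2 : ∏ i ∈ Finset.range L.length, (1 - (f i).foundProb P) ≤ Real.exp (-2) := by
    calc _ ≤ ∏ i ∈ Finset.range L.length, Real.exp (-(f i).foundProb P) :=
          Finset.prod_le_prod (fun i _ => sub_nonneg.2 ((f i).foundProb_le_one P))
            fun i _ => Real.one_sub_le_exp_neg _
      _ = Real.exp (-∑ i ∈ Finset.range L.length, (f i).foundProb P) := by
          rw [← Real.exp_sum, Finset.sum_neg_distrib]
      _ ≤ Real.exp (-2) := Real.exp_le_exp.2 (neg_le_neg hfound)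
  have h3 : Real.exp (-2) ≤ 1 / 3 := by
    rw [Real.exp_neg, inv_eq_one_div]
    exact one_div_le_one_div_of_le (by norm_num) (by linarith [Real.add_one_le_exp (2 : ℝ)])
  unfold successProb outputProb
  linarith

end QAlgorithm

/-- Circuits that succeed with constant probability if `4 ^ i / w` bounds the effective resistance
and `2 ^ (4 * 2 ^ j)` is large compared to the number of marked vertices. -/
def levelCircuits {w : ℝ} (hw : 0 < w) (i j : ℕ) : List QCircuit :=
  -- The factor `2 ^ j` in the number of averaged powers keeps the errors of the `4 * 2 ^ j` scales
  -- below `1 / 36` in total. One pass then has total success probability at least `1 / 12 - 1 / 36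
  -- = 1 / 18`, and 36 passes reach `2`. The final `- 1` is there because `averaging` with parameter
  -- `n` uses `n + 1` powers.
  (List.range 36).flatMap fun _ => (List.range (4 * 2 ^ j)).map fun s =>
    QCircuit.averaging (4 ^ i / w) (4 ^ i / w * 2 ^ (s + 1)) (by positivity) (by positivity)
      (24 * 2 ^ i * 2 ^ j - 1)

/-- The circuits of the levels `(i, j)` with `i + 3 * j = t`. -/
def stageCircuits {w : ℝ} (hw : 0 < w) (t : ℕ) : List QCircuit :=
  (List.range (t / 3 + 1)).flatMap fun j => levelCircuits hw (t - 3 * j) j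

def initialStages {w : ℝ} (hw : 0 < w) (n : ℕ) : List QCircuit :=
  (List.range n).flatMap (stageCircuits hw)

/-- The concatenation of all stages. -/
def circuitSequence {w : ℝ} (hw : 0 < w) (n : ℕ) : QCircuit :=
  -- Every stage contains a circuit, so the first `n + 1` stages have an entry `n` and the default
  -- is never used.
  (initialStages hw (n + 1)).getD n (QCircuit.averaging 1 1 one_pos one_pos 0)

/-! ### Cost of the stages -/

variable {w : ℝ} (hw : 0 < w)

theorem sum_cost_levelCircuits (i j : ℕ) :
    ((levelCircuits hw i j).map QCircuit.cost).sum = 3456 * 2 ^ i * 4 ^ j := by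
  have h1 : 0 < 24 * 2 ^ i * 2 ^ j := by positivity
  rw [levelCircuits, List.sum_map_flatMap_range]
  simp only [List.map_map, Function.comp_def, QCircuit.cost_averaging, Nat.sub_add_cancel h1]
  rw [show (4 : ℕ) ^ j = (2 ^ j) ^ 2 by rw [← pow_mul, pow_mul']; norm_num]
  simp
  ring

/-- With weight `3` on `j`, level `j` of the stage costs `3456 * 2 ^ (t - j)`, a geometric series.
Weight `2` would make all levels equally expensive and add a factor growing with `t`. -/
theorem sum_cost_stageCircuits_le (t : ℕ) :
    ((stageCircuits hw t).map QCircuit.cost).sum ≤ 6912 * 2 ^ t := by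
  rw [stageCircuits, List.sum_map_flatMap_range]
  have h : ∀ j ∈ Finset.range (t / 3 + 1),
      ((levelCircuits hw (t - 3 * j) j).map QCircuit.cost).sum = 3456 * 2 ^ (t - j) := by
    intro j hj
    have : 3 * j ≤ t := by have := Finset.mem_range.1 hj; omega
    rw [sum_cost_levelCircuits, show t - j = (t - 3 * j) + 2 * j by omega, pow_add, pow_mul]
    norm_num
    ring
  rw [Finset.sum_congr rfl h, ← Finset.mul_sum]
  have h2 := (Nat.le_add_right _ _).trans (sum_two_pow_sub_le t (t / 3 + 1) (by omega))
  rw [pow_succ] at h2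
  omega

theorem sum_cost_initialStages_le (n : ℕ) :
    ((initialStages hw n).map QCircuit.cost).sum ≤ 6912 * 2 ^ n := by
  rw [initialStages, List.sum_map_flatMap_range]
  refine (Finset.sum_le_sum fun t _ => sum_cost_stageCircuits_le hw t).trans ?_
  rw [← Finset.mul_sum]
  have : ∑ t ∈ Finset.range n, 2 ^ t < 2 ^ n := by
    induction n with
    | zero => simp
    | succ n ih => rw [Finset.sum_range_succ, pow_succ]; omega
  omega

theorem le_length_initialStages (n : ℕ) : n ≤ (initialStages hw n).length := by
  induction n with
  | zero => exact Nat.zero_le _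
  | succ n ih =>
    have h : 0 < (stageCircuits hw n).length := by
      rw [List.length_pos_iff_ne_nil, stageCircuits, List.range_succ_eq_map, List.flatMap_cons]
      intro h
      have h := (List.append_eq_nil_iff.1 h).1
      have := congrArg List.length h
      simp [levelCircuits] at this
    unfold initialStages at ih ⊢
    rw [List.range_succ, List.flatMap_append, List.length_append]
    simp only [List.flatMap_cons, List.flatMap_nil, List.append_nil]
    omega

theorem initialStages_prefix {m n : ℕ} (h : m ≤ n) :
    initialStages hw m <+: initialStages hw n := by
  obtain ⟨k, rfl⟩ := Nat.exists_eq_add_of_le h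
  unfold initialStages
  rw [List.range_add, List.flatMap_append]
  exact List.prefix_append _ _

theorem map_circuitSequence (n : ℕ) :
    (List.range (initialStages hw n).length).map (circuitSequence hw) = initialStages hw n := by
  refine List.ext_getElem (by simp) fun i h1 h2 => ?_
  have h3 : i < (initialStages hw (i + 1)).length := le_length_initialStages hw (i + 1)
  rw [List.getElem_map, List.getElem_range, circuitSequence, List.getD_eq_getElem _ _ h3]
  rcases le_total (i + 1) n with h | h
  · exact (initialStages_prefix hw h).getElem h3
  · exact ((initialStages_prefix hw h).getElem h2).symm

/-! ### Success at the right level and choice of the constants -/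

variable {V : Type*} [Fintype V] [DecidableEq V] {P : SearchProblem V} {R : ℝ}

theorem two_le_sum_foundProb_levelCircuits (hP : P.G.totalWeight ≤ w)
    (hR : P.G.ResistanceLE P.σ P.M R) (hM : P.M.Nonempty) {i j : ℕ} (hi : R * w ≤ 4 ^ i)
    (hj : 6 * (P.M.card : ℝ) ≤ 2 ^ (4 * 2 ^ j)) :
    2 ≤ ((levelCircuits hw i j).map fun c => c.foundProb P).sum := by
  set η : ℝ := 4 ^ i / w with hη
  have hη0 : 0 < η := by positivity
  choose v hv using fun s : ℕ => WeightedGraph.exists_isAugPotential (G := P.G) (M := P.M)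
    P.isDistribution hη0 (x := η * 2 ^ s) (by positivity)
  have hsum := hR.one_sixth_le_sum P.isDistribution hM hη0 ((le_div_iff₀ hw).2 hi) hj hv
  have h1 : 0 < 24 * 2 ^ i * 2 ^ j := by positivity
  have hn : ((24 * 2 ^ i * 2 ^ j - 1 : ℕ) : ℝ) + 1 = 24 * 2 ^ i * 2 ^ j := by
    rw [← Nat.cast_add_one, Nat.sub_add_cancel h1]
    push_cast
    rfl
  -- Since `η W ≤ 4 ^ i`, the numerator is at most `4 * 4 ^ i`, and the `4 ^ i` in the squared
  -- number of powers cancels it.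
  have herr : (2 * η * P.G.totalWeight + 2) / (24 * 2 ^ i * 2 ^ j) ^ 2 ≤ 1 / (144 * 2 ^ j) := by
    have e1 : η * P.G.totalWeight ≤ 4 ^ i := by
      refine (mul_le_mul_of_nonneg_left hP hη0.le).trans (le_of_eq ?_)
      rw [hη, div_mul_cancel₀ _ hw.ne']
    have e2 : (1 : ℝ) ≤ 4 ^ i := one_le_pow₀ (by norm_num)
    have e3 : (1 : ℝ) ≤ 2 ^ j := one_le_pow₀ (by norm_num)
    have e4 : ((2 : ℝ) ^ i) ^ 2 = 4 ^ i := by rw [← pow_mul, pow_mul']; norm_num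
    rw [div_le_div_iff₀ (by positivity) (by positivity), mul_pow, mul_pow, e4, one_mul]
    have e5 : 2 * η * P.G.totalWeight + 2 ≤ 4 * 4 ^ i := by linarith
    have e6 := mul_le_mul_of_nonneg_right e5 (by positivity : (0 : ℝ) ≤ 144 * 2 ^ j)
    have e7 : (4 : ℝ) ^ i * 2 ^ j * 1 ≤ 4 ^ i * 2 ^ j * 2 ^ j :=
      mul_le_mul_of_nonneg_left e3 (by positivity)
    nlinarith
  have hone : ∀ s : ℕ, 1 / 2 * (η * ∑ k ∈ P.M, v (s + 1) k ^ 2 / (η * 2 ^ (s + 1))) -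
      1 / (144 * 2 ^ j) ≤ (QCircuit.averaging η (η * 2 ^ (s + 1)) hη0 (by positivity)
        (24 * 2 ^ i * 2 ^ j - 1)).foundProb P := by
    intro s
    have h := QCircuit.le_foundProb_averaging hη0 (by positivity) (hv (s + 1))
      (24 * 2 ^ i * 2 ^ j - 1)
    rw [hn] at h
    linarith
  rw [levelCircuits, List.sum_map_flatMap_range]
  simp only [List.map_map, Function.comp_def, List.sum_map_range, Finset.sum_const,
    Finset.card_range, nsmul_eq_mul]
  have htot := Finset.sum_le_sum fun s (_ : s ∈ Finset.range (4 * 2 ^ j)) => hone s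
  rw [Finset.sum_sub_distrib, ← Finset.mul_sum, Finset.sum_const, Finset.card_range,
    nsmul_eq_mul] at htot
  have hc : ((4 * 2 ^ j : ℕ) : ℝ) * (1 / (144 * 2 ^ j)) = 1 / 36 := by
    push_cast
    field_simp
    norm_num
  rw [hc] at htot
  push_cast
  linarith

theorem two_thirds_le_successProb_circuitSequence (hP : P.G.totalWeight ≤ w)
    (hR : P.G.ResistanceLE P.σ P.M R) (hM : P.M.Nonempty) {i j T : ℕ} (hi : R * w ≤ 4 ^ i)
    (hj : 6 * (P.M.card : ℝ) ≤ 2 ^ (4 * 2 ^ j)) (hT : 13824 * 2 ^ (i + 3 * j) ≤ T) :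
    2 / 3 ≤ (QAlgorithm.ofSequence (circuitSequence hw)).successProb P T := by
  refine QAlgorithm.two_thirds_le_successProb (map_circuitSequence hw (i + 3 * j + 1)) P ?_ ?_
  · refine (sum_cost_initialStages_le hw _).trans (le_trans (le_of_eq ?_) hT)
    rw [pow_succ]
    ring
  · refine (two_le_sum_foundProb_levelCircuits hw hP hR hM hi hj).trans ?_
    have hnn : ∀ L : List QCircuit, 0 ≤ (L.map fun c => c.foundProb P).sum := fun L =>
      List.sum_nonneg fun a ha => by
        obtain ⟨c, _, rfl⟩ := List.mem_map.1 ha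
        exact c.foundProb_nonneg P
    have h1 : ((levelCircuits hw i j).map fun c => c.foundProb P).sum ≤
        ((stageCircuits hw (i + 3 * j)).map fun c => c.foundProb P).sum := by
      rw [stageCircuits, List.sum_map_flatMap_range]
      have h := Finset.single_le_sum (f := fun j' => ((levelCircuits hw (i + 3 * j - 3 * j') j').map
        fun c => c.foundProb P).sum) (fun j' _ => hnn _)
        (Finset.mem_range.2 (by omega : j < (i + 3 * j) / 3 + 1))
      simpa using h
    refine h1.trans ?_
    rw [initialStages, List.sum_map_flatMap_range]
    exact Finset.single_le_sum (f := fun t => ((stageCircuits hw t).map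
      fun c => c.foundProb P).sum) (fun t _ => hnn _) (Finset.mem_range.2 (Nat.lt_succ_self _))

theorem exists_pow_two_near {x : ℝ} (hx : 1 ≤ x) : ∃ n : ℕ, x ≤ 2 ^ n ∧ (2 : ℝ) ^ n ≤ 2 * x := by
  obtain ⟨n, h1, h2⟩ := exists_nat_pow_near hx one_lt_two
  exact ⟨n + 1, h2.le, by rw [pow_succ]; linarith⟩

theorem two_thirds_le_successProb_of_le (hP : P.G.totalWeight ≤ w)
    (hR : P.G.ResistanceLE P.σ P.M R) (hM : P.M.Nonempty) {X Y B : ℝ} (hX1 : 1 ≤ X)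
    (hX : R * w ≤ X ^ 2) (hY : 1 + Real.log P.M.card ≤ Y) (hB : 221184 * X * Y ^ 3 ≤ B) :
    2 / 3 ≤ (QAlgorithm.ofSequence (circuitSequence hw)).successProb P ⌊B⌋₊ := by
  have hm : (1 : ℝ) ≤ P.M.card := by exact_mod_cast hM.card_pos
  have hY1 : 1 ≤ Y := by linarith [Real.log_nonneg hm]
  obtain ⟨i, hi1, hi2⟩ := exists_pow_two_near hX1
  obtain ⟨j, hj1, hj2⟩ := exists_pow_two_near hY1
  refine two_thirds_le_successProb_circuitSequence hw hP hR hM (i := i) (j := j) ?_ ?_ ?_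
  · refine hX.trans ((pow_le_pow_left₀ (by linarith) hi1 2).trans (le_of_eq ?_))
    rw [← pow_mul, pow_mul']
    norm_num
  · have he1 : Real.exp 1 ≤ 4 := by linarith [Real.exp_one_lt_d9]
    have he2 : 6 ≤ Real.exp 2 := by
      have : Real.exp 2 = Real.exp 1 * Real.exp 1 := by rw [← Real.exp_add]; norm_num
      rw [this]
      nlinarith [Real.exp_one_gt_d9]
    -- From `1 + log |M| ≤ 2 ^ j` follows `2 + log |M| ≤ 2 * 2 ^ j`; the constant `2` in the
    -- exponent absorbs the factor `6`.
    calc 6 * (P.M.card : ℝ) ≤ Real.exp 2 * Real.exp (Real.log P.M.card) := by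
          rw [Real.exp_log (by linarith)]
          gcongr
      _ = Real.exp (2 + Real.log P.M.card) := (Real.exp_add _ _).symm
      _ ≤ Real.exp ((2 * 2 ^ j : ℕ) * 1) := by
          refine Real.exp_le_exp.2 ?_
          push_cast
          linarith [Real.log_nonneg hm]
      _ = Real.exp 1 ^ (2 * 2 ^ j) := Real.exp_nat_mul _ _
      _ ≤ 4 ^ (2 * 2 ^ j) := pow_le_pow_left₀ (Real.exp_pos 1).le he1 _
      _ = 2 ^ (4 * 2 ^ j) := by
          rw [show (4 : ℝ) = 2 ^ 2 by norm_num, ← pow_mul]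
          congr 1
          ring
  · refine Nat.le_floor (le_trans ?_ hB)
    push_cast
    rw [pow_add, mul_comm 3 j, pow_mul]
    have h3 : ((2 : ℝ) ^ j) ^ 3 ≤ (2 * Y) ^ 3 := pow_le_pow_left₀ (by positivity) hj2 3
    calc (13824 : ℝ) * (2 ^ i * (2 ^ j) ^ 3) ≤ 13824 * ((2 * X) * (2 * Y) ^ 3) := by gcongr
      _ = 221184 * X * Y ^ 3 := by ring

/-- The search algorithm; the given bound on the total weight is replaced by `1` if it is `0`. -/
def searchAlgorithm (w : ℝ) : QAlgorithm :=
  QAlgorithm.ofSequence (circuitSequence (w := if 0 < w then w else 1)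
    (by split_ifs <;> positivity))

/-- The performance of the search algorithm; `R` may be any upper bound on the resistance that is
zero in graphs without edges. -/
theorem two_thirds_le_successProb_searchAlgorithm (hP : P.G.totalWeight ≤ w)
    (hR : P.G.ResistanceLE P.σ P.M R) (hR0 : P.G.totalWeight = 0 → R = 0) (hM : P.M.Nonempty)
    {X Y B : ℝ} (hX1 : 1 ≤ X) (hX : √(R * w) ≤ X) (hY : 1 + Real.log P.M.card ≤ Y)
    (hB : 221184 * X * Y ^ 3 ≤ B) :
    2 / 3 ≤ (searchAlgorithm w).successProb P ⌊B⌋₊ := by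
  refine two_thirds_le_successProb_of_le _ ?_ hR hM hX1 ?_ hY hB
  · split_ifs
    · exact hP
    · linarith
  · split_ifs with h
    · exact (Real.sqrt_le_left (by linarith)).1 hX
    · have h0 : P.G.totalWeight = 0 := le_antisymm (by linarith) P.G.totalWeight_nonneg
      rw [hR0 h0, zero_mul]
      positivity

end

theorem theorem1 :
    ∃ C : ℝ, 0 < C ∧ ∃ alg : ℝ → QAlgorithm,
      (∀ (V : Type*) [Fintype V] [DecidableEq V] (P : SearchProblem V) (Wt : ℝ),
        P.G.totalWeight ≤ Wt →
        (∃ p, P.G.IsUnitFlow P.σ P.M p) →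
        2 / 3 ≤ (alg Wt).successProb P
          ⌊C * max 1 (Real.sqrt (P.resistance * Wt)) * (1 + Real.log (P.M.card : ℝ)) ^ 3⌋₊) ∧
      (∀ (V : Type*) [Fintype V] [DecidableEq V] (G : WeightedGraph V) (σ : V → ℝ)
        (hσ : σ ∈ stdSimplex ℝ V) (M : Finset V) (Wt : ℝ),
        G.totalWeight ≤ Wt →
        (∃ p, G.IsUnitFlow σ M p) →
        2 / 3 ≤ (alg (2 * Wt)).successProb (G.doubleCoverProblem σ hσ M)
          ⌊C * max 1 (Real.sqrt (G.effectiveResistance σ M * Wt)) *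
            (1 + Real.log (M.card : ℝ)) ^ 3⌋₊) := by
  -- This is `16 * 221184`; the factor `16` is used up by the double cover.
  refine ⟨3538944, by norm_num, searchAlgorithm, ?_, ?_⟩
  · rintro V _ _ P Wt hW ⟨p, hp⟩
    have hM := hp.nonempty_marked P.isDistribution
    have hL := Real.log_nonneg (by exact_mod_cast hM.card_pos : (1 : ℝ) ≤ P.M.card)
    refine two_thirds_le_successProb_searchAlgorithm hW hp.resistanceLE
      (fun h => WeightedGraph.effectiveResistance_eq_zero_of_totalWeight_eq_zero h hp) hM
      (le_max_left _ _) (le_max_right _ _) le_rfl ?_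
    have h1 : (1 : ℝ) ≤ max 1 √(P.resistance * Wt) := le_max_left _ _
    rw [SearchProblem.resistance] at h1 ⊢
    gcongr
    norm_num
  · rintro V _ _ G σ hσ M Wt hW ⟨p, hp⟩
    have hM := hp.nonempty_marked hσ
    have hm : (1 : ℝ) ≤ M.card := by exact_mod_cast hM.card_pos
    have hL := Real.log_nonneg hm
    set X := max 1 √(G.effectiveResistance σ M * Wt) with hX
    have hX1 : 1 ≤ X := le_max_left _ _
    have hXs : √(G.effectiveResistance σ M * Wt) ≤ X := le_max_right _ _
    have hW2 : (G.doubleCoverProblem σ hσ M).G.totalWeight = 2 * G.totalWeight :=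
      WeightedGraph.totalWeight_doubleCover
    -- Doubling the weight multiplies the square root by `√2 ≤ 2`, and doubling the marked set adds
    -- `log 2 ≤ 1` to the logarithm. Doubling both `X` and `Y` costs `2 * 2 ^ 3 = 16`.
    refine two_thirds_le_successProb_searchAlgorithm (X := 2 * X)
      (Y := 2 * (1 + Real.log M.card)) (by linarith) (hp.resistanceLE.doubleCover hσ)
      (fun h => WeightedGraph.effectiveResistance_eq_zero_of_totalWeight_eq_zero
        (by linarith) hp) ?_ (by linarith) ?_ ?_ (le_of_eq (by ring))
    · exact hM.product Finset.univ_nonempty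
    · refine Real.sqrt_le_iff.2 ⟨by linarith, ?_⟩
      have := (Real.sqrt_le_left (by linarith)).1 hXs
      nlinarith
    · have hcard : ((G.doubleCoverProblem σ hσ M).M.card : ℝ) = M.card * 2 := by
        simp [WeightedGraph.doubleCoverProblem, Finset.card_product]
      rw [hcard, Real.log_mul (by linarith) two_ne_zero]
      linarith [Real.log_two_lt_d9]
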